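/- **Conventions.** Identify $\mathbb E^3=\mathbb C\times\mathbb R$. For $\lambda\in\mathbb R$ let $M_\lambda(t)(X,z)=(e^{it}X,\;z+\lambda t)$ be the helicoidal motion of pitch $\lambda$ along the third axis (a rotation if $\lambda=0$). For $H\neq 0$ and an open interval $I$, a *cmc-$H$ helicoid of pitch $\lambda$ on $I\times\mathbb R$* is an immersion $\mathbf x(u,v)=M_\lambda(v)\,\mathbf c(u)$, where $\mathbf c\colon I\to\mathbb E^3$ is a smooth curve, with constant mean curvature $H$ with respect to the unit normal $\mathbf n=\mathbf x_u\times\mathbf x_v/|\mathbf x_u\times\mathbf x_v|$; here $H$ is half the trace of the second fundamental form $\langle d^2\mathbf x,\mathbf n\rangle$ with respect to the first fundamental form. For modulus $0\le k\le 1$ put $$E(\varphi,k)=\int_0^\varphi\sqrt{1-k^2\sin^2\theta}\,d\theta,\qquad \varPi(\varphi,n,k)=\int_0^\varphi\frac{d\theta}{(1-n\sin^2\theta)\sqrt{1-k^2\sin^2\theta}},$$ let $\mathrm{am}(\cdot,k)$ be the inverse function of $\varphi\mapsto\int_0^\varphi d\theta/\sqrt{1-k^2\sin^2\theta}$ (on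 $|\varphi|<\pi/2$ if $k=1$), and let $\mathrm{sn}=\sin\mathrm{am}$, $\mathrm{cn}=\cos\mathrm{am}$, $\mathrm{dn}=\sqrt{1-k^2\,\mathrm{sn}^2}$. **Proposition.** For $0\le a\le 1\le b$ and $H\ne0$ set $c_1=\sqrt{(1-a^2)(b^2-1)}$ and $g(u)=\frac{c_1}{b}\,\varPi\big(\mathrm{am}(bu,\tfrac ab),a^2,\tfrac ab\big)$, and define $\mathbf x_{a,b,H}\colon\mathbb R^2\to\mathbb E^3$ by $$-2H\,\mathbf x_{a,b,H}(u,v)=\begin{pmatrix} e^{iv}e^{ig(u)}\Big(\sqrt{1-a^2\mathrm{sn}^2}+\dfrac{a\,(b\,\mathrm{cn}\,\mathrm{dn}-i\,c_1\,\mathrm{sn})}{\sqrt{1-a^2\mathrm{sn}^2}}\Big)\\[2mm] -a\,\mathrm{sn}+(b^2-1)u-b\,E\big(\mathrm{am}(bu,\tfrac ab),\tfrac ab\big)+c_1v\end{pmatrix},$$ where $\mathrm{sn},\mathrm{cn},\mathrm{dn}$ are taken at $(bu,\tfrac ab)$. For $a=1$ (so $c_1=0$, $g=0$), $\sqrt{1-\mathrm{sn}^2}$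 is to be read as $\mathrm{cn}$, so that the first component is $e^{iv}(\mathrm{cn}+b\,\mathrm{dn})$. 1. For all $0\le a\le1\le b$ and $H\neq0$, $\mathbf x_{a,b,H}$ is a cmc-$H$ helicoid on $\mathbb R\times\mathbb R$, of pitch $-c_1/(2H)$, and its parameters are isothermal: $|\mathbf x_u|=|\mathbf x_v|$, $\mathbf x_u\perp\mathbf x_v$. If $b=1$ and $0<a<1$ it is an unduloid: a surface of revolution whose meridian is the graph of a non-constant function over the whole axis. If $a=1<b$ it is a nodoid: a surface of revolution whose meridian intersects itself. 2. Conversely, let $\mathbf x$ be any cmc-$H$ helicoid, of any pitch, on $I\times\mathbb R$. Then there are $a,b$ with $0\le a\le1\le b$, a sign $\varepsilon\in\{1,-1\}$, a number $t\in\mathbb R$ and smooth functions $\varphi,\psi\colon I\to\mathbb R$ with $\varepsilon\varphi'>0$ such that $$\mathbf x(u,v)=\mathbf x_{a,b,\varepsilon H}\big(\varphi(u),\,v+\psi(u)\big)+(0,0,t)\qquad\text{for all }u\in I,\ v\in\mathbb R.$$ Thus, up to a change of parameters, a choice of the unit normal (which changes the sign of $H$) and a translation along the axis, the cmc-$H$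 helicoids are the members of the two-parameter family $\mathbf x_{a,b,\pm H}$. -/

import Mathlib

open scoped Matrix ContDiff

noncomputable section

namespace CmcHelicoid

/-! ### Elliptic integrals and Jacobi elliptic functions of a real variable, modulus `0 ≤ k ≤ 1` -/

/-- Incomplete elliptic integral of the first kind,
`F(φ, k) = ∫₀^φ dθ / √(1 - k² sin² θ)`. -/
def ellipticF (φ k : ℝ) : ℝ :=
  ∫ θ in (0 : ℝ)..φ, 1 / Real.sqrt (1 - k ^ 2 * Real.sin θ ^ 2)

/-- Incomplete elliptic integral of the second kind,
`E(φ, k) = ∫₀^φ √(1 - k² sin² θ) dθ`. -/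
def ellipticE (φ k : ℝ) : ℝ :=
  ∫ θ in (0 : ℝ)..φ, Real.sqrt (1 - k ^ 2 * Real.sin θ ^ 2)

/-- Incomplete elliptic integral of the third kind,
`Π(φ, n, k) = ∫₀^φ dθ / ((1 - n sin² θ) √(1 - k² sin² θ))`. -/
def ellipticPi (φ n k : ℝ) : ℝ :=
  ∫ θ in (0 : ℝ)..φ,
    1 / ((1 - n * Real.sin θ ^ 2) * Real.sqrt (1 - k ^ 2 * Real.sin θ ^ 2))

/-- The interval that `F(·, k)` maps bijectively onto `ℝ`: the whole line for `0 ≤ k < 1`,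
and `(-π/2, π/2)` for `k = 1`, where the integrand `1 / |cos θ|` is not integrable up to `±π/2`. -/
def amRange (k : ℝ) : Set ℝ :=
  if k < 1 then Set.univ else Set.Ioo (-(Real.pi / 2)) (Real.pi / 2)

/-- Jacobi amplitude `am(w, k)`: the inverse function of `φ ↦ F(φ, k)`. -/
def am (w k : ℝ) : ℝ :=
  Function.invFunOn (fun φ => ellipticF φ k) (amRange k) w

/-- `sn(w, k) = sin am(w, k)`. -/
def sn (w k : ℝ) : ℝ := Real.sin (am w k)

/-- `cn(w, k) = cos am(w, k)`. -/
def cn (w k : ℝ) : ℝ := Real.cos (am w k)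

/-- `dn(w, k) = √(1 - k² sn²(w, k))`. -/
def dn (w k : ℝ) : ℝ := Real.sqrt (1 - k ^ 2 * sn w k ^ 2)

/-! ### Parametrized surfaces in Euclidean three-space -/

/-- Euclidean three-space in coordinates. The Euclidean inner product is `⬝ᵥ` and the vector
product is `⨯₃`; the norm of the function type is not used, only its topology. -/
abbrev E3 : Type := Fin 3 → ℝ

/-- `x_u` -/
def dU (x : ℝ → ℝ → E3) (u v : ℝ) : E3 := deriv (fun s => x s v) u

/-- `x_v` -/
def dV (x : ℝ → ℝ → E3) (u v : ℝ) : E3 := deriv (fun s => x u s) v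

/-- The normal direction `x_u × x_v`; it vanishes exactly where `x` fails to be an immersion. -/
def normalDir (x : ℝ → ℝ → E3) (u v : ℝ) : E3 := dU x u v ⨯₃ dV x u v

/-- The Gauss map `n = (x_u × x_v) / |x_u × x_v|`. -/
def gaussMap (x : ℝ → ℝ → E3) (u v : ℝ) : E3 :=
  (Real.sqrt (normalDir x u v ⬝ᵥ normalDir x u v))⁻¹ • normalDir x u v

/-- The mean curvature with respect to the Gauss map: half the trace of the second fundamental
form `⟨d²x, n⟩` with respect to the first fundamental form,
`(e G - 2 f F + g E) / (2 (E G - F²))`. -/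
def meanCurvature (x : ℝ → ℝ → E3) (u v : ℝ) : ℝ :=
  let fE := dU x u v ⬝ᵥ dU x u v
  let fF := dU x u v ⬝ᵥ dV x u v
  let fG := dV x u v ⬝ᵥ dV x u v
  let se := dU (dU x) u v ⬝ᵥ gaussMap x u v
  let sf := dV (dU x) u v ⬝ᵥ gaussMap x u v
  let sg := dV (dV x) u v ⬝ᵥ gaussMap x u v
  (se * fG - 2 * sf * fF + sg * fE) / (2 * (fE * fG - fF ^ 2))

/-- The parameters `(u, v)` are isothermal: the first fundamental form is proportional to
`du² + dv²`. -/
def IsIsothermal (x : ℝ → ℝ → E3) : Prop :=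
  ∀ u v, dU x u v ⬝ᵥ dU x u v = dV x u v ⬝ᵥ dV x u v ∧ dU x u v ⬝ᵥ dV x u v = 0

/-- The helicoidal motion with axis the third coordinate axis, pitch `l` and angle `t`
(a rotation if `l = 0`). -/
def helicoidalMotion (l t : ℝ) (p : E3) : E3 :=
  ![Real.cos t * p 0 - Real.sin t * p 1, Real.sin t * p 0 + Real.cos t * p 1, p 2 + l * t]

/-- `x`, on `I × ℝ` with `I` an open interval, is a cmc-`H` helicoid of pitch `l`: the immersed
trajectory, under the helicoidal motions of pitch `l`, of an arbitrary smooth generating curve `c`,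
with constant mean curvature `H ≠ 0`. -/
structure IsCmcHelicoid (H l : ℝ) (I : Set ℝ) (x : ℝ → ℝ → E3) : Prop where
  ne_zero : H ≠ 0
  isOpen : IsOpen I
  isPreconnected : IsPreconnected I
  helicoidal : ∃ c : ℝ → E3, ContDiffOn ℝ ∞ c I ∧
    ∀ u ∈ I, ∀ v, x u v = helicoidalMotion l v (c u)
  immersion : ∀ u ∈ I, ∀ v, normalDir x u v ≠ 0
  meanCurvature_eq : ∀ u ∈ I, ∀ v, meanCurvature x u v = H

/-- Distance from the axis along the curve `v = 0`. -/
def axisDist (x : ℝ → ℝ → E3) (u : ℝ) : ℝ := Real.sqrt (x u 0 0 ^ 2 + x u 0 1 ^ 2)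

/-- A (complete) unduloid: a cmc-`H` surface of revolution whose meridian is the graph, over the
whole axis, of a non-constant function. (A constant function gives a cylinder.) -/
def IsUnduloid (H : ℝ) (x : ℝ → ℝ → E3) : Prop :=
  IsCmcHelicoid H 0 Set.univ x ∧
    Function.Bijective (fun u => x u 0 2) ∧ ∃ u₁ u₂, axisDist x u₁ ≠ axisDist x u₂

/-- A nodoid: a cmc-`H` surface of revolution whose meridian, in the half-plane of pairs
(distance from the axis, height), intersects itself. -/
def IsNodoid (H : ℝ) (x : ℝ → ℝ → E3) : Prop :=
  IsCmcHelicoid H 0 Set.univ x ∧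
    ∃ u₁ u₂, u₁ ≠ u₂ ∧ axisDist x u₁ = axisDist x u₂ ∧ x u₁ 0 2 = x u₂ 0 2

/-! ### The explicit formula -/

/-- `c₁ = √((1 - a²)(b² - 1))` -/
def c₁ (a b : ℝ) : ℝ := Real.sqrt ((1 - a ^ 2) * (b ^ 2 - 1))

/-- `g(u) = (c₁ / b) Π(am(bu, a/b), a², a/b)`; it is `0` for `a = 1`, where `c₁ = 0`. -/
def phase (a b u : ℝ) : ℝ :=
  c₁ a b / b * ellipticPi (am (b * u) (a / b)) (a ^ 2) (a / b)

/-- `√(1 - a² sn²(bu, a/b))`, which for `a = 1` is to be read as `cn(bu, 1/b)`, the analytic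
square root of `1 - sn²`. -/
def rootFactor (a b u : ℝ) : ℝ :=
  if a = 1 then cn (b * u) (a / b) else Real.sqrt (1 - a ^ 2 * sn (b * u) (a / b) ^ 2)

/-- `a (b cn dn - i c₁ sn) / √(1 - a² sn²)` at `(bu, a/b)`; for `a = 1` the denominator is `cn`
and it cancels, leaving `b dn`. -/
def companionHoriz (a b u : ℝ) : ℂ :=
  if a = 1 then ((b * dn (b * u) (a / b) : ℝ) : ℂ)
  else (a : ℂ) * ((b * cn (b * u) (a / b) * dn (b * u) (a / b) : ℝ)
      - Complex.I * (c₁ a b * sn (b * u) (a / b) : ℝ)) / (rootFactor a b u : ℂ)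

/-- The horizontal part of `-2 H x`, as a complex number. -/
def horizontalPart (a b u v : ℝ) : ℂ :=
  Complex.exp (Complex.I * v) * (Complex.exp (Complex.I * phase a b u) *
    ((rootFactor a b u : ℂ) + companionHoriz a b u))

/-- The vertical part of `-2 H x`. -/
def verticalPart (a b u v : ℝ) : ℝ :=
  -a * sn (b * u) (a / b)
    + ((b ^ 2 - 1) * u - b * ellipticE (am (b * u) (a / b)) (a / b)) + c₁ a b * v

/-- The surface `x` with `-2 H x = (horizontalPart, verticalPart) ∈ ℂ × ℝ = E³`. -/
def explicitHelicoid (a b H u v : ℝ) : E3 :=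
  (-2 * H)⁻¹ • ![(horizontalPart a b u v).re, (horizontalPart a b u v).im, verticalPart a b u v]

end CmcHelicoid

end

open CmcHelicoid

open scoped Matrix ContDiff
noncomputable section
namespace CmcHelicoid

open Set Filter Topology

/-! A surface in isothermal parameters has mean curvature `H` exactly when `Δx = 2H x_u × x_v`. For
a helicoid, after scaling by `-2H`, this is an ODE for the generating curve `(f, h)` in `ℂ × ℝ`:
`f'' = (1 + h') f + i L f'` and `h'' = -Re (f' f̄)`, where `L` is the scaled pitch. The second
equation integrates to `h' = m - |f|²/2`, which leaves an autonomous second order equation for `f`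
alone.

Direct part. The horizontal profile splits as `P + Q`, and with `s = sn` the summands satisfy the
linear system `P' = i c₁ P - a s Q`, `Q' = -a s P` (`hasDerivAt_profileP`, `hasDerivAt_profileQ`).
Since `|P|²`, `|Q|²` and `Q P̄` are polynomials in the Jacobi functions, the ODE, its first integral
with `m = (a²b² - 1)/2`, and conformality become polynomial identities (`hasDerivAt_profileDeriv`,
`heightDeriv_eq`, `normSq_profileDeriv`, `im_profileDeriv_mul_conj`). The unduloid and nodoid
statements follow from the sign and symmetry of the derivative of the height.

Converse. Rotating the generating curve by an angle depending on `u`, and changing the speed, makes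
any helicoid isothermal, and the mean curvature equation turns into the ODE
(`exists_isConformalCurve`). The constants `L` and `m` determine `a` and `b` through `c₁ = L` and
`(ab)² = 2m + 1` (`exists_admissible`). The conformality relations confine the initial data to those
that occur on the explicit profile, up to a rotation (`exists_match`), and uniqueness for the ODE
identifies the two curves (`IsConformalCurve.eq_profile`). The rotation is absorbed into the change
of `v` and the translation along the axis. -/

/-! ### Elliptic integrals, the amplitude, and derivatives of the Jacobi functions -/

theorem hasDerivAt_integral_of_continuousOn {J : Set ℝ} (hJ : IsOpen J) (hc : J.OrdConnected)
    {f : ℝ → ℝ} (hf : ContinuousOn f J) {x₀ x : ℝ} (h₀ : x₀ ∈ J) (hx : x ∈ J) :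
    HasDerivAt (fun y => ∫ t in x₀..y, f t) (f x) x := by
  have hsub : uIcc x₀ x ⊆ J := hc.uIcc_subset h₀ hx
  refine intervalIntegral.integral_hasDerivAt_right ((hf.mono hsub).intervalIntegrable) ?_
    (hf.continuousAt (hJ.mem_nhds hx))
  exact hf.stronglyMeasurableAtFilter hJ x hx

theorem isOpen_amRange (k : ℝ) : IsOpen (amRange k) := by
  unfold amRange; split_ifs
  · exact isOpen_univ
  · exact isOpen_Ioo

theorem ordConnected_amRange (k : ℝ) : (amRange k).OrdConnected := by
  unfold amRange; split_ifs
  · exact ordConnected_univ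
  · exact ordConnected_Ioo

theorem zero_mem_amRange (k : ℝ) : (0 : ℝ) ∈ amRange k := by
  unfold amRange; split_ifs
  · trivial
  · constructor <;> linarith [Real.pi_pos]

theorem mem_amRange_of_lt_one {k : ℝ} (hk : k < 1) (θ : ℝ) : θ ∈ amRange k := by
  simp [amRange, hk]

theorem sq_mul_sin_sq_lt_one {k θ : ℝ} (h₀ : 0 ≤ k) (h₁ : k ≤ 1) (hθ : θ ∈ amRange k) :
    0 < 1 - k ^ 2 * Real.sin θ ^ 2 := by
  rcases h₁.lt_or_eq with h | rfl
  · nlinarith [Real.sin_sq_le_one θ, sq_nonneg (Real.sin θ)]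
  · simp only [amRange, lt_irrefl, if_false] at hθ
    have := Real.cos_pos_of_mem_Ioo hθ
    nlinarith [Real.sin_sq_add_cos_sq θ]

theorem continuousOn_ellipticF_integrand {k : ℝ} (h₀ : 0 ≤ k) (h₁ : k ≤ 1) :
    ContinuousOn (fun θ => 1 / Real.sqrt (1 - k ^ 2 * Real.sin θ ^ 2)) (amRange k) := by
  refine ContinuousOn.div (by fun_prop) (by fun_prop) fun θ hθ => ?_
  exact (Real.sqrt_pos.2 (sq_mul_sin_sq_lt_one h₀ h₁ hθ)).ne'

theorem hasDerivAt_ellipticF {k θ : ℝ} (h₀ : 0 ≤ k) (h₁ : k ≤ 1) (hθ : θ ∈ amRange k) :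
    HasDerivAt (fun φ => ellipticF φ k) (1 / Real.sqrt (1 - k ^ 2 * Real.sin θ ^ 2)) θ :=
  hasDerivAt_integral_of_continuousOn (isOpen_amRange k) (ordConnected_amRange k)
    (continuousOn_ellipticF_integrand h₀ h₁) (zero_mem_amRange k) hθ

theorem hasDerivAt_ellipticE (k θ : ℝ) :
    HasDerivAt (fun φ => ellipticE φ k) (Real.sqrt (1 - k ^ 2 * Real.sin θ ^ 2)) θ :=
  hasDerivAt_integral_of_continuousOn (J := univ) isOpen_univ ordConnected_univ
    (f := fun θ => Real.sqrt (1 - k ^ 2 * Real.sin θ ^ 2)) (by fun_prop) (mem_univ _) (mem_univ _)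

theorem hasDerivAt_ellipticPi {a k θ : ℝ} (ha₀ : 0 ≤ a) (ha : a < 1) (h₀ : 0 ≤ k) (h₁ : k < 1) :
    HasDerivAt (fun φ => ellipticPi φ (a ^ 2) k)
      (1 / ((1 - a ^ 2 * Real.sin θ ^ 2) * Real.sqrt (1 - k ^ 2 * Real.sin θ ^ 2))) θ := by
  refine hasDerivAt_integral_of_continuousOn (J := univ) isOpen_univ ordConnected_univ
    (f := fun θ => 1 / ((1 - a ^ 2 * Real.sin θ ^ 2) * Real.sqrt (1 - k ^ 2 * Real.sin θ ^ 2)))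
    ?_ (mem_univ _) (mem_univ _)
  refine ContinuousOn.div (by fun_prop) (by fun_prop) fun θ _ => ?_
  refine mul_ne_zero ?_ ?_
  · exact (sq_mul_sin_sq_lt_one ha₀ ha.le (mem_amRange_of_lt_one ha θ)).ne'
  · exact (Real.sqrt_pos.2 (sq_mul_sin_sq_lt_one h₀ h₁.le (mem_amRange_of_lt_one h₁ θ))).ne'

theorem ellipticF_zero (k : ℝ) : ellipticF 0 k = 0 := by simp [ellipticF]

theorem ellipticE_zero (k : ℝ) : ellipticE 0 k = 0 := by simp [ellipticE]

theorem strictMonoOn_ellipticF {k : ℝ} (h₀ : 0 ≤ k) (h₁ : k ≤ 1) :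
    StrictMonoOn (fun φ => ellipticF φ k) (amRange k) := by
  refine strictMonoOn_of_deriv_pos (ordConnected_amRange k).convex
    (fun θ hθ => (hasDerivAt_ellipticF h₀ h₁ hθ).continuousAt.continuousWithinAt) fun θ hθ => ?_
  have hθ' := interior_subset hθ
  rw [(hasDerivAt_ellipticF h₀ h₁ hθ').deriv]
  exact one_div_pos.2 (Real.sqrt_pos.2 (sq_mul_sin_sq_lt_one h₀ h₁ hθ'))

/-- At modulus 1 the substitution `sin θ = tanh w` turns `dθ / √(1 - sin² θ)` into `dw`, so the
amplitude is the Gudermannian. This explicit inverse gives surjectivity where the integral diverges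
at the ends of `amRange`. -/
theorem ellipticF_arcsin_tanh (w : ℝ) :
    Real.arcsin (Real.tanh w) ∈ amRange 1 ∧ ellipticF (Real.arcsin (Real.tanh w)) 1 = w := by
  have hb : ∀ w : ℝ, -1 < Real.tanh w ∧ Real.tanh w < 1 := fun w =>
    ⟨Real.neg_one_lt_tanh w, Real.tanh_lt_one w⟩
  have hmem : ∀ w : ℝ, Real.arcsin (Real.tanh w) ∈ amRange 1 := fun w => by
    simp only [amRange, lt_irrefl, if_false]
    exact ⟨Real.neg_pi_div_two_lt_arcsin.2 (hb w).1, Real.arcsin_lt_pi_div_two.2 (hb w).2⟩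
  refine ⟨hmem w, ?_⟩
  have hd : ∀ w, HasDerivAt (fun w => ellipticF (Real.arcsin (Real.tanh w)) 1 - w) 0 w := by
    intro w
    have h1 := hasDerivAt_ellipticF zero_le_one le_rfl (hmem w)
    have h2 := (Real.hasDerivAt_arcsin (hb w).1.ne' (hb w).2.ne)
    have h3 : HasDerivAt Real.tanh (1 - Real.tanh w ^ 2) w := by
      have := (Real.hasDerivAt_sinh w).div (Real.hasDerivAt_cosh w) (Real.cosh_pos w).ne'
      have he : Real.tanh = Real.sinh / Real.cosh := funext Real.tanh_eq_sinh_div_cosh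
      rw [he]
      refine this.congr_deriv ?_
      have := (Real.cosh_pos w).ne'
      simp only [Pi.div_apply]
      field_simp
    have h4 := (HasDerivAt.comp w h1 (h2.comp w h3)).sub (hasDerivAt_id w)
    refine h4.congr_deriv ?_
    have hpos : 0 < 1 - Real.tanh w ^ 2 := by nlinarith [(hb w).1, (hb w).2]
    rw [Real.sin_arcsin (hb w).1.le (hb w).2.le]
    simp only [one_pow, one_mul]
    have hs := Real.sq_sqrt hpos.le
    have hs' := (Real.sqrt_pos.2 hpos).ne'
    field_simp
    linarith
  have hconst := is_const_of_deriv_eq_zero (fun w => (hd w).differentiableAt)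
    (fun w => (hd w).deriv) w 0
  simp [ellipticF_zero] at hconst
  linarith

theorem surjOn_ellipticF {k : ℝ} (h₀ : 0 ≤ k) (h₁ : k ≤ 1) :
    SurjOn (fun φ => ellipticF φ k) (amRange k) univ := by
  rcases h₁.lt_or_eq with h | rfl
  · have hr : amRange k = univ := by simp [amRange, h]
    have hd := fun θ => hasDerivAt_ellipticF h₀ h₁ (mem_amRange_of_lt_one h θ)
    have hcont : Continuous fun φ => ellipticF φ k :=
      continuous_iff_continuousAt.2 fun θ => (hd θ).continuousAt
    -- The integrand is at least 1, so `F` grows at least as fast as the identity and is unbounded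
    -- in both directions.
    have hmono : Monotone fun φ => ellipticF φ k - φ := by
      have hd' : ∀ θ, HasDerivAt (fun φ => ellipticF φ k - φ) _ θ :=
        fun θ => (hd θ).sub (hasDerivAt_id θ)
      refine monotone_of_deriv_nonneg (fun θ => (hd' θ).differentiableAt) fun θ => ?_
      rw [(hd' θ).deriv, sub_nonneg]
      have hp := sq_mul_sin_sq_lt_one h₀ h₁ (mem_amRange_of_lt_one h θ)
      rw [le_div_iff₀ (Real.sqrt_pos.2 hp), one_mul, Real.sqrt_le_iff]
      exact ⟨zero_le_one, by nlinarith [mul_nonneg (sq_nonneg k) (sq_nonneg (Real.sin θ))]⟩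
    have hz : ellipticF 0 k = 0 := ellipticF_zero k
    have hsurj : Function.Surjective fun φ => ellipticF φ k := by
      refine hcont.surjective ?_ ?_
      · refine tendsto_atTop_mono' _ ?_ tendsto_id
        filter_upwards [eventually_ge_atTop 0] with x hx
        have := hmono hx; simp only [hz] at this; simp only [id]; linarith
      · refine tendsto_atBot_mono' _ ?_ tendsto_id
        filter_upwards [eventually_le_atBot 0] with x hx
        have := hmono hx; simp only [hz] at this; simp only [id]; linarith
    rw [hr]
    exact fun w _ => let ⟨θ, hθ⟩ := hsurj w; ⟨θ, trivial, hθ⟩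
  · exact fun w _ => ⟨_, (ellipticF_arcsin_tanh w).1, (ellipticF_arcsin_tanh w).2⟩

theorem am_mem {k : ℝ} (h₀ : 0 ≤ k) (h₁ : k ≤ 1) (w : ℝ) : am w k ∈ amRange k :=
  Function.invFunOn_mem (surjOn_ellipticF h₀ h₁ (mem_univ w))

theorem ellipticF_am {k : ℝ} (h₀ : 0 ≤ k) (h₁ : k ≤ 1) (w : ℝ) : ellipticF (am w k) k = w :=
  Function.invFunOn_eq (surjOn_ellipticF h₀ h₁ (mem_univ w))

theorem am_ellipticF {k θ : ℝ} (h₀ : 0 ≤ k) (h₁ : k ≤ 1) (hθ : θ ∈ amRange k) :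
    am (ellipticF θ k) k = θ :=
  (strictMonoOn_ellipticF h₀ h₁).injOn (am_mem h₀ h₁ _) hθ (ellipticF_am h₀ h₁ _)

theorem strictMono_am {k : ℝ} (h₀ : 0 ≤ k) (h₁ : k ≤ 1) : StrictMono fun w => am w k := by
  intro w w' hw
  refine (strictMonoOn_ellipticF h₀ h₁).lt_iff_lt (am_mem h₀ h₁ w) (am_mem h₀ h₁ w') |>.1 ?_
  simpa only [ellipticF_am h₀ h₁] using hw

theorem dn_pos {k : ℝ} (h₀ : 0 ≤ k) (h₁ : k ≤ 1) (w : ℝ) : 0 < dn w k :=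
  Real.sqrt_pos.2 (sq_mul_sin_sq_lt_one h₀ h₁ (am_mem h₀ h₁ w))

theorem dn_sq {k : ℝ} (h₀ : 0 ≤ k) (h₁ : k ≤ 1) (w : ℝ) : dn w k ^ 2 = 1 - k ^ 2 * sn w k ^ 2 :=
  Real.sq_sqrt (sq_mul_sin_sq_lt_one h₀ h₁ (am_mem h₀ h₁ w)).le

theorem cn_sq (w k : ℝ) : cn w k ^ 2 = 1 - sn w k ^ 2 := Real.cos_sq' _

/-- A strictly monotone function whose image is open is continuous; the inverse function rule then
applies to `F`. -/
theorem hasDerivAt_am {k : ℝ} (h₀ : 0 ≤ k) (h₁ : k ≤ 1) (w : ℝ) :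
    HasDerivAt (fun w => am w k) (dn w k) w := by
  have himage : (fun w => am w k) '' univ = amRange k := by
    ext θ
    constructor
    · rintro ⟨w, -, rfl⟩; exact am_mem h₀ h₁ w
    · exact fun hθ => ⟨_, trivial, am_ellipticF h₀ h₁ hθ⟩
  have hcont : ContinuousAt (fun w => am w k) w := by
    refine ((strictMono_am h₀ h₁).strictMonoOn univ).continuousAt_of_image_mem_nhds univ_mem ?_
    rw [himage]
    exact (isOpen_amRange k).mem_nhds (am_mem h₀ h₁ w)
  have h := (hasDerivAt_ellipticF h₀ h₁ (am_mem h₀ h₁ w)).of_local_left_inverse hcont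
    (one_div_pos.2 (dn_pos h₀ h₁ w)).ne' (Eventually.of_forall fun w => ellipticF_am h₀ h₁ w)
  simpa [dn, sn] using h

theorem hasDerivAt_sn {k : ℝ} (h₀ : 0 ≤ k) (h₁ : k ≤ 1) (w : ℝ) :
    HasDerivAt (fun w => sn w k) (cn w k * dn w k) w :=
  (hasDerivAt_am h₀ h₁ w).sin

theorem hasDerivAt_cn {k : ℝ} (h₀ : 0 ≤ k) (h₁ : k ≤ 1) (w : ℝ) :
    HasDerivAt (fun w => cn w k) (-sn w k * dn w k) w :=
  (hasDerivAt_am h₀ h₁ w).cos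

theorem hasDerivAt_dn {k : ℝ} (h₀ : 0 ≤ k) (h₁ : k ≤ 1) (w : ℝ) :
    HasDerivAt (fun w => dn w k) (-k ^ 2 * sn w k * cn w k) w := by
  have h := ((((hasDerivAt_sn h₀ h₁ w).pow 2).const_mul (k ^ 2)).const_sub 1).sqrt
    (sq_mul_sin_sq_lt_one h₀ h₁ (am_mem h₀ h₁ w)).ne'
  refine h.congr_deriv ?_
  have hd : Real.sqrt (1 - k ^ 2 * sn w k ^ 2) = dn w k := rfl
  have := (dn_pos h₀ h₁ w).ne'
  simp only [Pi.pow_apply, hd]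
  field_simp
  ring

/-! ### The family parameters and the rescaled Jacobi functions -/

/-- The parameters `0 ≤ a ≤ 1 ≤ b` of the family. -/
structure IsAdmissible (a b : ℝ) : Prop where
  nonneg : 0 ≤ a
  le_one : a ≤ 1
  one_le : 1 ≤ b

namespace IsAdmissible

variable {a b : ℝ}

theorem pos (h : IsAdmissible a b) : 0 < b := zero_lt_one.trans_le h.one_le

theorem modulus_nonneg (h : IsAdmissible a b) : 0 ≤ a / b := div_nonneg h.nonneg h.pos.le

theorem modulus_le_one (h : IsAdmissible a b) : a / b ≤ 1 :=
  (div_le_one h.pos).2 (h.le_one.trans h.one_le)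

theorem modulus_lt_one (h : IsAdmissible a b) (ha : a < 1) : a / b < 1 :=
  (div_lt_one h.pos).2 (ha.trans_le h.one_le)

theorem c₁_sq (h : IsAdmissible a b) : c₁ a b ^ 2 = (1 - a ^ 2) * (b ^ 2 - 1) :=
  Real.sq_sqrt (mul_nonneg (by nlinarith [h.nonneg, h.le_one]) (by nlinarith [h.one_le]))

end IsAdmissible

/-- `sn(bu, a/b)` -/
def jacS (a b u : ℝ) : ℝ := sn (b * u) (a / b)

/-- `cn(bu, a/b)` -/
def jacC (a b u : ℝ) : ℝ := cn (b * u) (a / b)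

/-- `b dn(bu, a/b)` -/
def jacB (a b u : ℝ) : ℝ := b * dn (b * u) (a / b)

section Jacobi

variable {a b : ℝ}

theorem hasDerivAt_const_mul_id (b u : ℝ) : HasDerivAt (fun u => b * u) b u := by
  simpa using (hasDerivAt_id u).const_mul b

theorem hasDerivAt_jacS (h : IsAdmissible a b) (u : ℝ) :
    HasDerivAt (jacS a b) (jacC a b u * jacB a b u) u := by
  refine ((hasDerivAt_sn h.modulus_nonneg h.modulus_le_one (b * u)).comp u
    (hasDerivAt_const_mul_id b u)).congr_deriv ?_
  simp only [jacC, jacB]; ring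

theorem hasDerivAt_jacC (h : IsAdmissible a b) (u : ℝ) :
    HasDerivAt (jacC a b) (-jacS a b u * jacB a b u) u := by
  refine ((hasDerivAt_cn h.modulus_nonneg h.modulus_le_one (b * u)).comp u
    (hasDerivAt_const_mul_id b u)).congr_deriv ?_
  simp only [jacS, jacB]; ring

theorem hasDerivAt_jacB (h : IsAdmissible a b) (u : ℝ) :
    HasDerivAt (jacB a b) (-a ^ 2 * jacS a b u * jacC a b u) u := by
  refine (((hasDerivAt_dn h.modulus_nonneg h.modulus_le_one (b * u)).comp u
    (hasDerivAt_const_mul_id b u)).const_mul b).congr_deriv ?_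
  have := h.pos.ne'
  simp only [jacS, jacC]
  field_simp

theorem jacC_sq (a b u : ℝ) : jacC a b u ^ 2 = 1 - jacS a b u ^ 2 := cn_sq _ _

theorem jacB_sq (h : IsAdmissible a b) (u : ℝ) :
    jacB a b u ^ 2 = b ^ 2 - a ^ 2 * jacS a b u ^ 2 := by
  have := h.pos.ne'
  rw [jacB, mul_pow, dn_sq h.modulus_nonneg h.modulus_le_one, jacS]
  field_simp

theorem jacB_pos (h : IsAdmissible a b) (u : ℝ) : 0 < jacB a b u :=
  mul_pos h.pos (dn_pos h.modulus_nonneg h.modulus_le_one _)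

theorem jacS_sq_le_one (a b u : ℝ) : jacS a b u ^ 2 ≤ 1 := Real.sin_sq_le_one _

end Jacobi

/-! ### The profile curve: its differential equations and algebraic identities -/

/-- The term `e^{ig} √(1 - a² sn²)` of the profile curve. -/
def profileP (a b u : ℝ) : ℂ := Complex.exp (Complex.I * phase a b u) * rootFactor a b u

/-- The term `e^{ig} a (b cn dn - i c₁ sn) / √(1 - a² sn²)` of the profile curve. -/
def profileQ (a b u : ℝ) : ℂ := Complex.exp (Complex.I * phase a b u) * companionHoriz a b u

/-- The horizontal part of `-2 H x` along `v = 0`. -/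
def profile (a b u : ℝ) : ℂ := profileP a b u + profileQ a b u

/-- The vertical part of `-2 H x` along `v = 0`. -/
def height (a b u : ℝ) : ℝ :=
  -a * jacS a b u + ((b ^ 2 - 1) * u - b * ellipticE (am (b * u) (a / b)) (a / b))

theorem horizontalPart_eq (a b u v : ℝ) :
    horizontalPart a b u v = Complex.exp (Complex.I * v) * profile a b u := by
  simp only [horizontalPart, profile, profileP, profileQ]; ring

theorem verticalPart_eq (a b u v : ℝ) : verticalPart a b u v = height a b u + c₁ a b * v := rfl

section Profile

variable {a b : ℝ}

theorem c₁_one (b : ℝ) : c₁ 1 b = 0 := by simp [c₁]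

theorem phase_one (b u : ℝ) : phase 1 b u = 0 := by simp [phase, c₁_one]

theorem profileP_one (b u : ℝ) : profileP 1 b u = jacC 1 b u := by
  simp [profileP, phase_one, rootFactor, jacC]

theorem profileQ_one (b u : ℝ) : profileQ 1 b u = jacB 1 b u := by
  simp [profileQ, phase_one, companionHoriz, jacB]

theorem one_sub_jacS_sq_pos (h : IsAdmissible a b) (ha : a < 1) (u : ℝ) :
    0 < 1 - a ^ 2 * jacS a b u ^ 2 := by
  nlinarith [jacS_sq_le_one a b u, sq_nonneg (jacS a b u), h.nonneg]

theorem rootFactor_of_lt (ha : a < 1) (u : ℝ) :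
    rootFactor a b u = Real.sqrt (1 - a ^ 2 * jacS a b u ^ 2) := if_neg ha.ne

theorem rootFactor_pos (h : IsAdmissible a b) (ha : a < 1) (u : ℝ) : 0 < rootFactor a b u := by
  rw [rootFactor_of_lt ha]; exact Real.sqrt_pos.2 (one_sub_jacS_sq_pos h ha u)

theorem rootFactor_sq (h : IsAdmissible a b) (u : ℝ) :
    rootFactor a b u ^ 2 = 1 - a ^ 2 * jacS a b u ^ 2 := by
  rcases h.le_one.lt_or_eq with ha | rfl
  · rw [rootFactor_of_lt ha, Real.sq_sqrt (one_sub_jacS_sq_pos h ha u).le]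
  · simpa [rootFactor, jacC] using jacC_sq 1 b u

theorem hasDerivAt_rootFactor (h : IsAdmissible a b) (ha : a < 1) (u : ℝ) :
    HasDerivAt (rootFactor a b)
      (-a ^ 2 * jacS a b u * (jacC a b u * jacB a b u) / rootFactor a b u) u := by
  have hf : rootFactor a b = fun u => Real.sqrt (1 - a ^ 2 * jacS a b u ^ 2) :=
    funext fun u => rootFactor_of_lt ha u
  have h1 := (((((hasDerivAt_jacS h u).pow 2).const_mul (a ^ 2)).const_sub 1).sqrt
    (one_sub_jacS_sq_pos h ha u).ne')
  rw [hf]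
  refine h1.congr_deriv ?_
  have hR := (Real.sqrt_pos.2 (one_sub_jacS_sq_pos h ha u)).ne'
  simp only [Pi.pow_apply]
  field_simp
  ring

theorem hasDerivAt_phase (h : IsAdmissible a b) (ha : a < 1) (u : ℝ) :
    HasDerivAt (phase a b) (c₁ a b / rootFactor a b u ^ 2) u := by
  have hk := h.modulus_lt_one ha
  have h1 := (((hasDerivAt_ellipticPi h.nonneg ha h.modulus_nonneg hk).comp u
    ((hasDerivAt_am h.modulus_nonneg hk.le (b * u)).comp u
      (hasDerivAt_const_mul_id b u)))).const_mul (c₁ a b / b)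
  refine h1.congr_deriv ?_
  have hd : Real.sqrt (1 - (a / b) ^ 2 * Real.sin (am (b * u) (a / b)) ^ 2)
      = dn (b * u) (a / b) := rfl
  have hs : Real.sin (am (b * u) (a / b)) = jacS a b u := rfl
  have hd0 := (dn_pos h.modulus_nonneg hk.le (b * u)).ne'
  have hb := h.pos.ne'
  have hp := (one_sub_jacS_sq_pos h ha u).ne'
  simp only [Function.comp_apply]
  rw [hd, hs, rootFactor_sq h]
  field_simp

theorem companionHoriz_of_lt (ha : a < 1) (u : ℝ) :
    companionHoriz a b u = a * ((jacC a b u * jacB a b u : ℝ)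
      - Complex.I * (c₁ a b * jacS a b u : ℝ)) / rootFactor a b u := by
  rw [companionHoriz, if_neg ha.ne]
  simp only [jacC, jacB, jacS]
  push_cast
  ring

theorem hasDerivAt_exp_phase (h : IsAdmissible a b) (ha : a < 1) (u : ℝ) :
    HasDerivAt (fun u => Complex.exp (Complex.I * phase a b u))
      (Complex.exp (Complex.I * phase a b u)
        * (Complex.I * (c₁ a b / rootFactor a b u ^ 2 : ℝ))) u :=
  (((hasDerivAt_phase h ha u).ofReal_comp).const_mul Complex.I).cexp

/-- The phase has speed `c₁ / R²` with `R` the root factor, and `R² + a² sn² = 1` makes the system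
for `P`, `Q` linear. For `a = 1` the phase vanishes, `R = cn` may be zero, and `P = cn`, `Q = b dn`
are treated directly. -/
theorem hasDerivAt_profileP (h : IsAdmissible a b) (u : ℝ) :
    HasDerivAt (profileP a b)
      (Complex.I * c₁ a b * profileP a b u - a * jacS a b u * profileQ a b u) u := by
  rcases h.le_one.lt_or_eq with ha | rfl
  · refine ((hasDerivAt_exp_phase h ha u).mul
      (hasDerivAt_rootFactor h ha u).ofReal_comp).congr_deriv ?_
    have hR : (rootFactor a b u : ℂ) ≠ 0 := by exact_mod_cast (rootFactor_pos h ha u).ne'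
    have hR2 : (rootFactor a b u : ℂ) ^ 2 = 1 - a ^ 2 * jacS a b u ^ 2 := by
      exact_mod_cast rootFactor_sq h u
    rw [profileP, profileQ, companionHoriz_of_lt ha]
    push_cast
    field_simp
    linear_combination (-Complex.I * c₁ a b) * hR2
  · have hf : profileP 1 b = fun u => (jacC 1 b u : ℂ) := funext fun u => profileP_one b u
    rw [hf]
    refine (hasDerivAt_jacC h u).ofReal_comp.congr_deriv ?_
    simp [c₁_one, profileQ_one]

theorem hasDerivAt_profileQ (h : IsAdmissible a b) (u : ℝ) :
    HasDerivAt (profileQ a b) (-(a * jacS a b u) * profileP a b u) u := by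
  rcases h.le_one.lt_or_eq with ha | rfl
  · have hf : profileQ a b = fun u => Complex.exp (Complex.I * phase a b u) *
        (a * (((jacC a b u * jacB a b u : ℝ) : ℂ)
          - Complex.I * (c₁ a b * jacS a b u : ℝ)) / rootFactor a b u) := by
      funext u; rw [profileQ, companionHoriz_of_lt ha]
    have hR : (rootFactor a b u : ℂ) ≠ 0 := by exact_mod_cast (rootFactor_pos h ha u).ne'
    have h1 : HasDerivAt (fun u => ((jacC a b u * jacB a b u : ℝ) : ℂ)) _ u :=
      ((hasDerivAt_jacC h u).mul (hasDerivAt_jacB h u)).ofReal_comp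
    have h2 : HasDerivAt (fun u => ((c₁ a b * jacS a b u : ℝ) : ℂ)) _ u :=
      ((hasDerivAt_jacS h u).const_mul (c₁ a b)).ofReal_comp
    rw [hf]
    refine ((hasDerivAt_exp_phase h ha u).mul
      (((h1.sub (h2.const_mul Complex.I)).const_mul (a : ℂ)).div
        (hasDerivAt_rootFactor h ha u).ofReal_comp hR)).congr_deriv ?_
    have hR2 : (rootFactor a b u : ℂ) ^ 2 = 1 - a ^ 2 * jacS a b u ^ 2 := by
      exact_mod_cast rootFactor_sq h u
    have hC2 : (jacC a b u : ℂ) ^ 2 = 1 - jacS a b u ^ 2 := by exact_mod_cast jacC_sq a b u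
    have hB2 : (jacB a b u : ℂ) ^ 2 = b ^ 2 - a ^ 2 * jacS a b u ^ 2 := by
      exact_mod_cast jacB_sq h u
    have hc2 : (c₁ a b : ℂ) ^ 2 = (1 - a ^ 2) * (b ^ 2 - 1) := by exact_mod_cast h.c₁_sq
    rw [profileP]
    simp only [Pi.sub_apply, Pi.div_apply]
    push_cast
    field_simp
    set R : ℂ := ((rootFactor a b u : ℝ) : ℂ)
    set S : ℂ := ((jacS a b u : ℝ) : ℂ)
    set C : ℂ := ((jacC a b u : ℝ) : ℂ)
    set B : ℂ := ((jacB a b u : ℝ) : ℂ)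
    set c : ℂ := ((c₁ a b : ℝ) : ℂ)
    linear_combination (a * (-S * B ^ 2 - a ^ 2 * S * C ^ 2 - Complex.I * c * C * B)
      + a * S * (R ^ 2 + (1 - a ^ 2 * S ^ 2))) * hR2
      + a * (-(1 - a ^ 2 * S ^ 2) * a ^ 2 * S + a ^ 2 * S * B ^ 2) * hC2
      + a * (-(1 - a ^ 2 * S ^ 2) * S + a ^ 2 * (1 - S ^ 2) * S) * hB2 + a * S * hc2
      - a * S * c ^ 2 * Complex.I_sq
  · have hf : profileQ 1 b = fun u => (jacB 1 b u : ℂ) := funext fun u => profileQ_one b u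
    rw [hf]
    refine (hasDerivAt_jacB h u).ofReal_comp.congr_deriv ?_
    simp [profileP_one]

theorem normSq_exp_I_mul (t : ℝ) :
    (Complex.exp (Complex.I * t)).re ^ 2 + (Complex.exp (Complex.I * t)).im ^ 2 = 1 := by
  rw [mul_comm, Complex.exp_ofReal_mul_I_re, Complex.exp_ofReal_mul_I_im]
  exact Real.cos_sq_add_sin_sq t

theorem normSq_profileP (h : IsAdmissible a b) (u : ℝ) :
    (profileP a b u).re ^ 2 + (profileP a b u).im ^ 2 = 1 - a ^ 2 * jacS a b u ^ 2 := by
  have hw := normSq_exp_I_mul (phase a b u)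
  rw [profileP, Complex.re_mul_ofReal, Complex.im_mul_ofReal, ← rootFactor_sq h]
  linear_combination rootFactor a b u ^ 2 * hw

theorem companionHoriz_mul_rootFactor (h : IsAdmissible a b) (u : ℝ) :
    (companionHoriz a b u).re * rootFactor a b u = a * (jacC a b u * jacB a b u) ∧
    (companionHoriz a b u).im * rootFactor a b u = -(a * (c₁ a b * jacS a b u)) := by
  rcases h.le_one.lt_or_eq with ha | rfl
  · have hR := (rootFactor_pos h ha u).ne'
    rw [companionHoriz_of_lt ha, Complex.div_ofReal_re, Complex.div_ofReal_im]
    field_simp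
    simp only [Complex.mul_re, Complex.mul_im, Complex.sub_re, Complex.sub_im, Complex.ofReal_re,
      Complex.ofReal_im, Complex.I_re, Complex.I_im]
    constructor <;> ring
  · simp [companionHoriz, rootFactor, jacC, jacB, c₁_one]
    ring

/-- In `Q P̄` the phases cancel and the root factor clears the denominator of `Q`. The result is
polynomial in the Jacobi functions, also at zeros of `cn` when `a = 1`, and the later norm
identities rest on it. -/
theorem profileQ_mul_conj_profileP (h : IsAdmissible a b) (u : ℝ) :
    (profileQ a b u).re * (profileP a b u).re + (profileQ a b u).im * (profileP a b u).im
      = a * (jacC a b u * jacB a b u) ∧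
    (profileQ a b u).im * (profileP a b u).re - (profileQ a b u).re * (profileP a b u).im
      = -(a * (c₁ a b * jacS a b u)) := by
  have hw := normSq_exp_I_mul (phase a b u)
  obtain ⟨h1, h2⟩ := companionHoriz_mul_rootFactor h u
  rw [profileP, profileQ, Complex.re_mul_ofReal, Complex.im_mul_ofReal, Complex.mul_re,
    Complex.mul_im, ← h1, ← h2]
  set w := Complex.exp (Complex.I * phase a b u)
  constructor
  · linear_combination (companionHoriz a b u).re * rootFactor a b u * hw
  · linear_combination (companionHoriz a b u).im * rootFactor a b u * hw

theorem normSq_profileQ (h : IsAdmissible a b) (u : ℝ) :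
    (profileQ a b u).re ^ 2 + (profileQ a b u).im ^ 2 = a ^ 2 * (b ^ 2 - jacS a b u ^ 2) := by
  rcases h.le_one.lt_or_eq with ha | rfl
  · have h1 := normSq_profileP h u
    obtain ⟨h2, h3⟩ := profileQ_mul_conj_profileP h u
    have hpos := (one_sub_jacS_sq_pos h ha u).ne'
    have hc := h.c₁_sq
    have hC := jacC_sq a b u
    have hB := jacB_sq h u
    -- The identity `|Q|² |P|² = |Q P̄|²` determines `|Q|²`, because `|P|² = 1 - a² sn²` is positive
    -- for `a < 1`.
    refine mul_right_cancel₀ hpos ?_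
    set S := jacS a b u
    set C := jacC a b u
    set B := jacB a b u
    set c := c₁ a b
    set Q := profileQ a b u
    set P := profileP a b u
    linear_combination -(Q.re ^ 2 + Q.im ^ 2) * h1
      + (Q.re * P.re + Q.im * P.im + a * (C * B)) * h2
      + (Q.im * P.re - Q.re * P.im - a * (c * S)) * h3
      + a ^ 2 * B ^ 2 * hC + a ^ 2 * (1 - S ^ 2) * hB + a ^ 2 * S ^ 2 * hc
  · simp only [profileQ_one, Complex.ofReal_re, Complex.ofReal_im, jacB_sq h]
    ring

/-- The derivative of `profile`. -/
def profileDeriv (a b u : ℝ) : ℂ :=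
  Complex.I * c₁ a b * profileP a b u - a * jacS a b u * profile a b u

/-- The derivative of `height`. -/
def heightDeriv (a b u : ℝ) : ℝ :=
  a ^ 2 * jacS a b u ^ 2 - 1 - a * (jacC a b u * jacB a b u)

theorem hasDerivAt_profile (h : IsAdmissible a b) (u : ℝ) :
    HasDerivAt (profile a b) (profileDeriv a b u) u := by
  refine ((hasDerivAt_profileP h u).add (hasDerivAt_profileQ h u)).congr_deriv ?_
  rw [profileDeriv, profile]; ring

theorem hasDerivAt_height (h : IsAdmissible a b) (u : ℝ) :
    HasDerivAt (height a b) (heightDeriv a b u) u := by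
  have hE := (hasDerivAt_ellipticE (a / b) (am (b * u) (a / b))).comp u
    ((hasDerivAt_am h.modulus_nonneg h.modulus_le_one (b * u)).comp u (hasDerivAt_const_mul_id b u))
  refine (((hasDerivAt_jacS h u).const_mul (-a)).add
    ((hasDerivAt_const_mul_id (b ^ 2 - 1) u).sub (hE.const_mul b))).congr_deriv ?_
  have hd : Real.sqrt (1 - (a / b) ^ 2 * Real.sin (am (b * u) (a / b)) ^ 2)
      = dn (b * u) (a / b) := rfl
  have hB := jacB_sq h u
  rw [jacB] at hB
  rw [heightDeriv, jacB, hd]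
  linear_combination -hB

/-- This is the horizontal component of `Δy = -y_u × y_v` for `y = -2H x`. -/
theorem hasDerivAt_profileDeriv (h : IsAdmissible a b) (u : ℝ) :
    HasDerivAt (profileDeriv a b)
      ((1 + heightDeriv a b u) * profile a b u + Complex.I * c₁ a b * profileDeriv a b u) u := by
  refine (((hasDerivAt_profileP h u).const_mul (Complex.I * c₁ a b)).sub
    (((hasDerivAt_jacS h u).ofReal_comp.const_mul (a : ℂ)).mul (hasDerivAt_profile h u))).congr_deriv
    ?_
  simp only [heightDeriv, profileDeriv, profile]
  push_cast
  ring

theorem normSq_profile (h : IsAdmissible a b) (u : ℝ) :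
    (profile a b u).re ^ 2 + (profile a b u).im ^ 2
      = 1 + a ^ 2 * b ^ 2 - 2 * a ^ 2 * jacS a b u ^ 2 + 2 * a * (jacC a b u * jacB a b u) := by
  have h1 := normSq_profileP h u
  obtain ⟨h2, h3⟩ := profileQ_mul_conj_profileP h u
  have h4 := normSq_profileQ h u
  rw [profile, Complex.add_re, Complex.add_im]
  linear_combination h1 + 2 * h2 + h4

/-- The first integral of the vertical equation. It shows that the product `ab` is the constant of
integration. -/
theorem heightDeriv_eq (h : IsAdmissible a b) (u : ℝ) :
    heightDeriv a b u = (a ^ 2 * b ^ 2 - 1) / 2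
      - ((profile a b u).re ^ 2 + (profile a b u).im ^ 2) / 2 := by
  rw [normSq_profile h, heightDeriv]; ring

theorem profileDeriv_re_im (a b u : ℝ) :
    (profileDeriv a b u).re
      = -(c₁ a b * (profileP a b u).im) - a * jacS a b u * (profile a b u).re ∧
    (profileDeriv a b u).im
      = c₁ a b * (profileP a b u).re - a * jacS a b u * (profile a b u).im := by
  constructor <;> simp [profileDeriv]

theorem im_profileDeriv_mul_conj (h : IsAdmissible a b) (u : ℝ) :
    (profileDeriv a b u).im * (profile a b u).re - (profileDeriv a b u).re * (profile a b u).im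
      = -(c₁ a b * heightDeriv a b u) := by
  have h1 := normSq_profileP h u
  obtain ⟨h2, h3⟩ := profileQ_mul_conj_profileP h u
  obtain ⟨h4, h5⟩ := profileDeriv_re_im a b u
  rw [h4, h5, heightDeriv]
  simp only [profile, Complex.add_re, Complex.add_im]
  linear_combination c₁ a b * h1 + c₁ a b * h2

/-- The square on the right makes the radial velocity vanish or have the sign of `-a sn`; this
decides on which half of the profile given initial data lie. -/
theorem re_profileDeriv_mul_conj (h : IsAdmissible a b) (u : ℝ) :
    (profileDeriv a b u).re * (profile a b u).re + (profileDeriv a b u).im * (profile a b u).im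
      = -(a * jacS a b u * (jacB a b u + a * jacC a b u) ^ 2) := by
  obtain ⟨h2, h3⟩ := profileQ_mul_conj_profileP h u
  obtain ⟨h4, h5⟩ := profileDeriv_re_im a b u
  have h6 := normSq_profile h u
  have hc := h.c₁_sq
  have hC := jacC_sq a b u
  have hB := jacB_sq h u
  have h7 : -(c₁ a b * (profileP a b u).im) * (profile a b u).re
      + c₁ a b * (profileP a b u).re * (profile a b u).im
      = -(a * (c₁ a b ^ 2 * jacS a b u)) := by
    simp only [profile, Complex.add_re, Complex.add_im]
    linear_combination c₁ a b * h3
  rw [h4, h5]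
  linear_combination h7 - a * jacS a b u * h6 - a * jacS a b u * hc
    + a * jacS a b u * hB + a ^ 3 * jacS a b u * hC

theorem normSq_profileDeriv (h : IsAdmissible a b) (u : ℝ) :
    (profileDeriv a b u).re ^ 2 + (profileDeriv a b u).im ^ 2 + heightDeriv a b u ^ 2
      = (profile a b u).re ^ 2 + (profile a b u).im ^ 2 + c₁ a b ^ 2 := by
  have h1 := normSq_profileP h u
  obtain ⟨h2, h3⟩ := profileQ_mul_conj_profileP h u
  obtain ⟨h4, h5⟩ := profileDeriv_re_im a b u
  have h6 := normSq_profile h u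
  have hc := h.c₁_sq
  have hC := jacC_sq a b u
  have hB := jacB_sq h u
  have h7 : -((profileP a b u).im) * (profile a b u).re
      + (profileP a b u).re * (profile a b u).im = -(a * (c₁ a b * jacS a b u)) := by
    simp only [profile, Complex.add_re, Complex.add_im]
    linear_combination h3
  rw [h4, h5, heightDeriv]
  set S := jacS a b u
  set C := jacC a b u
  set B := jacB a b u
  set c := c₁ a b
  linear_combination c ^ 2 * h1 - 2 * a * S * c * h7 + (a ^ 2 * S ^ 2 - 1) * h6
    + a ^ 2 * S ^ 2 * hc + a ^ 2 * B ^ 2 * hC + a ^ 2 * (1 - S ^ 2) * hB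

/-- If the conformal factor vanished, so would the profile, `c₁` and the derivative of the height.
The first integral would give `ab = 1`, hence `a = b = 1`. There the amplitude stays inside `(-π/2,
π/2)`, so `cn > 0` and the height is strictly decreasing, a contradiction. -/
theorem normSq_profile_add_c₁_sq_pos (h : IsAdmissible a b) (u : ℝ) :
    0 < (profile a b u).re ^ 2 + (profile a b u).im ^ 2 + c₁ a b ^ 2 := by
  by_contra! hle
  have hp : (profile a b u).re ^ 2 + (profile a b u).im ^ 2 = 0 := by
    nlinarith [sq_nonneg (profile a b u).re, sq_nonneg (profile a b u).im, sq_nonneg (c₁ a b)]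
  have hc : c₁ a b ^ 2 = 0 := by
    nlinarith [sq_nonneg (profile a b u).re, sq_nonneg (profile a b u).im, sq_nonneg (c₁ a b)]
  have hh : heightDeriv a b u = 0 := by
    have := normSq_profileDeriv h u
    rw [hp, hc] at this
    nlinarith [sq_nonneg (profileDeriv a b u).re, sq_nonneg (profileDeriv a b u).im,
      sq_nonneg (heightDeriv a b u)]
  have hab : a * b = 1 := by
    have := heightDeriv_eq h u
    rw [hp, hh] at this
    nlinarith [mul_nonneg h.nonneg h.pos.le]
  rw [h.c₁_sq] at hc
  have ha1 : a = 1 := by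
    rcases mul_eq_zero.1 hc with h' | h'
    · nlinarith [h.nonneg]
    · have : b = 1 := by nlinarith [h.one_le]
      simpa [this] using hab
  subst ha1
  have hb1 : b = 1 := by linarith
  subst hb1
  have hC : 0 < jacC 1 1 u := by
    have := am_mem (k := 1 / 1) (by norm_num) (by norm_num) (1 * u)
    simp only [amRange, div_one, lt_irrefl, if_false] at this
    simp only [jacC, cn, div_one]
    exact Real.cos_pos_of_mem_Ioo this
  have hB := jacB_pos h u
  have hC2 := jacC_sq 1 1 u
  rw [heightDeriv] at hh
  nlinarith [mul_pos hC hB, mul_pos hC hC]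

theorem contDiff_succ_of_hasDerivAt {F : Type*} [NormedAddCommGroup F] [NormedSpace ℝ F] {n : ℕ}
    {f f' : ℝ → F} (hd : ∀ u, HasDerivAt f (f' u) u) (hf' : ContDiff ℝ n f') :
    ContDiff ℝ (n + 1 : ℕ) f := by
  push_cast
  refine contDiff_succ_iff_deriv.2 ⟨fun u => (hd u).differentiableAt, by simp, ?_⟩
  rwa [show deriv f = f' from funext fun u => (hd u).deriv]

/-- The derivatives of these five functions are polynomials in the same functions, so each order of
smoothness yields the next. -/
theorem contDiff_nat_jacobi_profile (h : IsAdmissible a b) (n : ℕ) :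
    ContDiff ℝ n (jacS a b) ∧ ContDiff ℝ n (jacC a b) ∧ ContDiff ℝ n (jacB a b) ∧
      ContDiff ℝ n (profileP a b) ∧ ContDiff ℝ n (profileQ a b) := by
  induction n with
  | zero =>
    simp only [Nat.cast_zero, contDiff_zero]
    exact ⟨continuous_iff_continuousAt.2 fun u => (hasDerivAt_jacS h u).continuousAt,
      continuous_iff_continuousAt.2 fun u => (hasDerivAt_jacC h u).continuousAt,
      continuous_iff_continuousAt.2 fun u => (hasDerivAt_jacB h u).continuousAt,
      continuous_iff_continuousAt.2 fun u => (hasDerivAt_profileP h u).continuousAt,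
      continuous_iff_continuousAt.2 fun u => (hasDerivAt_profileQ h u).continuousAt⟩
  | succ n ih =>
    obtain ⟨hS, hC, hB, hP, hQ⟩ := ih
    have hS' : ContDiff ℝ n fun u => (jacS a b u : ℂ) := Complex.ofRealCLM.contDiff.comp hS
    exact ⟨contDiff_succ_of_hasDerivAt (hasDerivAt_jacS h) (hC.mul hB),
      contDiff_succ_of_hasDerivAt (hasDerivAt_jacC h) (hS.neg.mul hB),
      contDiff_succ_of_hasDerivAt (hasDerivAt_jacB h) ((contDiff_const.mul hS).mul hC),
      contDiff_succ_of_hasDerivAt (hasDerivAt_profileP h)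
        ((contDiff_const.mul hP).sub ((contDiff_const.mul hS').mul hQ)),
      contDiff_succ_of_hasDerivAt (hasDerivAt_profileQ h) ((contDiff_const.mul hS').neg.mul hP)⟩

theorem contDiff_profile (h : IsAdmissible a b) : ContDiff ℝ ∞ (profile a b) :=
  contDiff_infty.2 fun n =>
    let ⟨_, _, _, hP, hQ⟩ := contDiff_nat_jacobi_profile h n
    hP.add hQ

theorem contDiff_height (h : IsAdmissible a b) : ContDiff ℝ ∞ (height a b) := by
  refine contDiff_infty.2 fun n => ContDiff.of_le (n := (n + 1 : ℕ)) ?_ (by norm_cast; omega)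
  obtain ⟨hS, hC, hB, -, -⟩ := contDiff_nat_jacobi_profile h n
  exact contDiff_succ_of_hasDerivAt (hasDerivAt_height h)
    (((contDiff_const.mul (hS.pow 2)).sub contDiff_const).sub (contDiff_const.mul (hC.mul hB)))

end Profile

/-! ### Helicoidal motions and mean curvature in a conformal frame -/

/-- The point of `E³ = ℂ × ℝ` with the given horizontal and vertical parts. -/
def toE3 (z : ℂ) (t : ℝ) : E3 := ![z.re, z.im, t]

/-- The velocity field of the helicoidal motions of pitch `l`. -/
def axisField (l : ℝ) (p : E3) : E3 := ![-p 1, p 0, l]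

theorem helicoidalMotion_toE3 (l v : ℝ) (z : ℂ) (t : ℝ) :
    helicoidalMotion l v (toE3 z t) = toE3 (Complex.exp (Complex.I * v) * z) (t + l * v) := by
  ext i
  fin_cases i <;>
    simp [helicoidalMotion, toE3, mul_comm Complex.I, Complex.exp_ofReal_mul_I_re,
      Complex.exp_ofReal_mul_I_im]
  ring

theorem axisField_toE3 (l : ℝ) (z : ℂ) (t : ℝ) :
    axisField l (toE3 z t) = toE3 (Complex.I * z) l := by
  ext i
  fin_cases i <;> simp [axisField, toE3]

theorem hasDerivAt_toE3 {z : ℝ → ℂ} {z' : ℂ} {t : ℝ → ℝ} {t' u : ℝ}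
    (hz : HasDerivAt z z' u) (ht : HasDerivAt t t' u) :
    HasDerivAt (fun s => toE3 (z s) (t s)) (toE3 z' t') u := by
  have hre : HasDerivAt (fun s => (z s).re) z'.re u :=
    Complex.reCLM.hasFDerivAt.comp_hasDerivAt u hz
  have him : HasDerivAt (fun s => (z s).im) z'.im u :=
    Complex.imCLM.hasFDerivAt.comp_hasDerivAt u hz
  refine hasDerivAt_pi.2 fun i => ?_
  fin_cases i
  · exact hre
  · exact him
  · exact ht

theorem hasDerivAt_helicoidalMotion {c : ℝ → E3} {c' : E3} {u : ℝ} (l v : ℝ)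
    (hc : HasDerivAt c c' u) :
    HasDerivAt (fun s => helicoidalMotion l v (c s)) (helicoidalMotion 0 v c') u := by
  have h := hasDerivAt_pi.1 hc
  refine hasDerivAt_pi.2 fun i => ?_
  fin_cases i
  · exact ((h 0).const_mul _).sub ((h 1).const_mul _)
  · exact ((h 0).const_mul _).add ((h 1).const_mul _)
  · simpa [helicoidalMotion] using h 2

theorem hasDerivAt_helicoidalMotion_angle (l v : ℝ) (p : E3) :
    HasDerivAt (fun s => helicoidalMotion l s p) (helicoidalMotion 0 v (axisField l p)) v := by
  refine hasDerivAt_pi.2 fun i => ?_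
  fin_cases i
  · refine (((Real.hasDerivAt_cos v).mul_const (p 0)).sub
      ((Real.hasDerivAt_sin v).mul_const (p 1))).congr_deriv ?_
    simp [helicoidalMotion, axisField]; ring
  · refine (((Real.hasDerivAt_sin v).mul_const (p 0)).add
      ((Real.hasDerivAt_cos v).mul_const (p 1))).congr_deriv ?_
    simp [helicoidalMotion, axisField]; ring
  · refine (((hasDerivAt_id v).const_mul l).const_add (p 2)).congr_deriv ?_
    simp [helicoidalMotion, axisField]

theorem helicoidalMotion_zero_dotProduct (v : ℝ) (p q : E3) :
    helicoidalMotion 0 v p ⬝ᵥ helicoidalMotion 0 v q = p ⬝ᵥ q := by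
  simp [helicoidalMotion, dotProduct, Fin.sum_univ_three]
  linear_combination (p 0 * q 0 + p 1 * q 1) * Real.sin_sq_add_cos_sq v

theorem helicoidalMotion_zero_cross (v : ℝ) (p q : E3) :
    helicoidalMotion 0 v p ⨯₃ helicoidalMotion 0 v q = helicoidalMotion 0 v (p ⨯₃ q) := by
  ext i
  fin_cases i <;> simp [helicoidalMotion, cross_apply]
  · ring
  · ring
  · linear_combination (p 0 * q 1 - p 1 * q 0) * Real.sin_sq_add_cos_sq v

/-- Half the trace of the second fundamental form with respect to the first one, for a surface with
first derivatives `A, T` and second derivatives `P, Q, S`. -/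
def traceQuotient (A T P Q S : E3) : ℝ :=
  let n := (Real.sqrt (A ⨯₃ T ⬝ᵥ A ⨯₃ T))⁻¹ • A ⨯₃ T
  ((P ⬝ᵥ n) * (T ⬝ᵥ T) - 2 * (Q ⬝ᵥ n) * (A ⬝ᵥ T) + (S ⬝ᵥ n) * (A ⬝ᵥ A)) /
    (2 * ((A ⬝ᵥ A) * (T ⬝ᵥ T) - (A ⬝ᵥ T) ^ 2))

theorem meanCurvature_eq_traceQuotient (x : ℝ → ℝ → E3) (u v : ℝ) :
    meanCurvature x u v = traceQuotient (dU x u v) (dV x u v) (dU (dU x) u v) (dV (dU x) u v)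
      (dV (dV x) u v) := rfl

theorem traceQuotient_helicoidalMotion (v : ℝ) (A T P Q S : E3) :
    traceQuotient (helicoidalMotion 0 v A) (helicoidalMotion 0 v T) (helicoidalMotion 0 v P)
      (helicoidalMotion 0 v Q) (helicoidalMotion 0 v S) = traceQuotient A T P Q S := by
  simp only [traceQuotient, helicoidalMotion_zero_cross, dotProduct_smul,
    helicoidalMotion_zero_dotProduct]

theorem cross_dotProduct_cross_self {Y T : E3} {G : ℝ} (hY : Y ⬝ᵥ Y = G) (hT : T ⬝ᵥ T = G)
    (hYT : Y ⬝ᵥ T = 0) : Y ⨯₃ T ⬝ᵥ Y ⨯₃ T = G ^ 2 := by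
  rw [cross_dot_cross, hY, hT, hYT, dotProduct_comm T Y, hYT]; ring

theorem cross_combination (p q : ℝ) (Y T : E3) : (p • Y + q • T) ⨯₃ T = p • Y ⨯₃ T := by
  simp [map_add, map_smul]

/-- The mean curvature in terms of a conformal frame `Y, T` with `x_u = p Y + q T`, `x_v = T`. -/
theorem traceQuotient_conformal {Y T Z R S : E3} {G p q α β : ℝ} (hG : 0 < G) (hp : p ≠ 0)
    (hY : Y ⬝ᵥ Y = G) (hT : T ⬝ᵥ T = G) (hYT : Y ⬝ᵥ T = 0) :
    traceQuotient (p • Y + q • T) T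
      (p ^ 2 • Z + (2 * q * p) • R + q ^ 2 • S + α • Y + β • T) (p • R + q • S) S
      = p / |p| * ((Z + S) ⬝ᵥ Y ⨯₃ T) / (2 * G ^ 2) := by
  have hTY : T ⬝ᵥ Y = 0 := by rw [dotProduct_comm, hYT]
  have hN := cross_dotProduct_cross_self hY hT hYT
  have hsq : Real.sqrt (p * (p * G ^ 2)) = |p| * G := by
    rw [show p * (p * G ^ 2) = (|p| * G) ^ 2 by rw [mul_pow, sq_abs]; ring,
      Real.sqrt_sq (by positivity)]
  have hp' : |p| ≠ 0 := abs_ne_zero.2 hp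
  have hpp : |p| ^ 2 = p ^ 2 := sq_abs p
  -- Here the first fundamental form is `(p² + q²)G`, `qG`, `G`. The tangential terms with `α`, `β`
  -- drop out, the terms in `R` cancel, and `p² G (Z + S)` remains in the numerator.
  simp only [traceQuotient, cross_combination, smul_dotProduct, dotProduct_smul, add_dotProduct,
    dotProduct_add, hY, hT, hYT, hTY, hN, dot_self_cross, dot_cross_self, smul_eq_mul, hsq]
  field_simp
  ring_nf
  field_simp

/-- A vector orthogonal to an orthogonal frame is a multiple of the vector product. -/
theorem eq_smul_cross {Y T W : E3} {G : ℝ} (hG : 0 < G) (hY : Y ⬝ᵥ Y = G) (hT : T ⬝ᵥ T = G)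
    (hYT : Y ⬝ᵥ T = 0) (hWY : W ⬝ᵥ Y = 0) (hWT : W ⬝ᵥ T = 0) :
    W = ((W ⬝ᵥ Y ⨯₃ T) / G ^ 2) • Y ⨯₃ T := by
  have hN := cross_dotProduct_cross_self hY hT hYT
  -- The triple product expansion has coefficients `W ⬝ᵥ Y` and `W ⬝ᵥ T`. Expanding a further
  -- product with `Y ⨯₃ T` then solves for `W`.
  have h1 : W ⨯₃ (Y ⨯₃ T) = 0 := by
    rw [cross_cross_eq_smul_sub_smul', dotProduct_comm Y W, hWY, hWT]; simp
  have h2 : (Y ⨯₃ T) ⨯₃ (W ⨯₃ (Y ⨯₃ T)) = 0 := by rw [h1]; simp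
  rw [cross_cross_eq_smul_sub_smul', hN, sub_eq_zero] at h2
  rw [div_eq_inv_mul, mul_smul, ← h2, smul_smul, inv_mul_cancel₀ (by positivity), one_smul]

section Derivatives

variable {l : ℝ} {I : Set ℝ} {x : ℝ → ℝ → E3} {c : ℝ → E3}

theorem hasDerivAt_of_contDiffOn {F : Type*} [NormedAddCommGroup F] [NormedSpace ℝ F]
    {c : ℝ → F} (hI : IsOpen I) (hc : ContDiffOn ℝ ∞ c I) {u : ℝ} (hu : u ∈ I) :
    HasDerivAt c (deriv c u) u :=
  ((hc.differentiableOn (by simp)).differentiableAt (hI.mem_nhds hu)).hasDerivAt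

theorem contDiffOn_deriv {F : Type*} [NormedAddCommGroup F] [NormedSpace ℝ F]
    {c : ℝ → F} (hI : IsOpen I) (hc : ContDiffOn ℝ ∞ c I) : ContDiffOn ℝ ∞ (deriv c) I :=
  ((contDiffOn_infty_iff_deriv_of_isOpen hI).1 hc).2

theorem dU_eq (hI : IsOpen I) (hc : ContDiffOn ℝ ∞ c I)
    (hx : ∀ u ∈ I, ∀ v, x u v = helicoidalMotion l v (c u)) {u : ℝ} (hu : u ∈ I) (v : ℝ) :
    dU x u v = helicoidalMotion 0 v (deriv c u) := by
  refine HasDerivAt.deriv ((hasDerivAt_helicoidalMotion l v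
    (hasDerivAt_of_contDiffOn hI hc hu)).congr_of_eventuallyEq ?_)
  filter_upwards [hI.mem_nhds hu] with s hs using hx s hs v

theorem dV_eq (hx : ∀ u ∈ I, ∀ v, x u v = helicoidalMotion l v (c u)) {u : ℝ} (hu : u ∈ I)
    (v : ℝ) : dV x u v = helicoidalMotion 0 v (axisField l (c u)) := by
  rw [dV, show (fun s => x u s) = fun s => helicoidalMotion l s (c u) from funext (hx u hu)]
  exact (hasDerivAt_helicoidalMotion_angle l v (c u)).deriv

/-- The first derivatives of a helicoid are themselves trajectories of curves under the motions of
pitch 0, so `dU_eq` and `dV_eq` apply to them again. All the vectors at `v` are rotated copies of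
those at `v = 0`, and the trace is rotation invariant. -/
theorem meanCurvature_helicoid (hI : IsOpen I) (hc : ContDiffOn ℝ ∞ c I)
    (hx : ∀ u ∈ I, ∀ v, x u v = helicoidalMotion l v (c u)) {u : ℝ} (hu : u ∈ I) (v : ℝ) :
    meanCurvature x u v = traceQuotient (deriv c u) (axisField l (c u)) (deriv (deriv c) u)
      (axisField 0 (deriv c u)) (axisField 0 (axisField l (c u))) := by
  have h1 : ∀ u ∈ I, ∀ v, dU x u v = helicoidalMotion 0 v (deriv c u) := fun u hu =>
    dU_eq hI hc hx hu
  have h2 : ∀ u ∈ I, ∀ v, dV x u v = helicoidalMotion 0 v (axisField l (c u)) := fun u hu =>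
    dV_eq hx hu
  rw [meanCurvature_eq_traceQuotient, h1 u hu, h2 u hu, dU_eq hI (contDiffOn_deriv hI hc) h1 hu,
    dV_eq h1 hu, dV_eq (c := fun u => axisField l (c u)) h2 hu, traceQuotient_helicoidalMotion]

theorem normalDir_helicoid (hI : IsOpen I) (hc : ContDiffOn ℝ ∞ c I)
    (hx : ∀ u ∈ I, ∀ v, x u v = helicoidalMotion l v (c u)) {u : ℝ} (hu : u ∈ I) (v : ℝ) :
    normalDir x u v = helicoidalMotion 0 v (deriv c u ⨯₃ axisField l (c u)) := by
  rw [normalDir, dU_eq hI hc hx hu, dV_eq hx hu, helicoidalMotion_zero_cross]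

end Derivatives

theorem dotProduct_toE3 (z w : ℂ) (s t : ℝ) :
    toE3 z s ⬝ᵥ toE3 w t = z.re * w.re + z.im * w.im + s * t := by
  simp [toE3, dotProduct, Fin.sum_univ_three]

theorem cross_toE3 (p f : ℂ) (s l : ℝ) :
    toE3 p s ⨯₃ toE3 (Complex.I * f) l
      = toE3 (-(s * f + Complex.I * l * p)) (p.re * f.re + p.im * f.im) := by
  ext i
  fin_cases i <;> simp [toE3, cross_apply] <;> ring

theorem toE3_add (z w : ℂ) (s t : ℝ) : toE3 z s + toE3 w t = toE3 (z + w) (s + t) := by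
  ext i
  fin_cases i <;> simp [toE3]

theorem smul_toE3 (r : ℝ) (z : ℂ) (t : ℝ) : r • toE3 z t = toE3 (r * z) (r * t) := by
  ext i
  fin_cases i <;> simp [toE3]

theorem contDiffOn_toE3 {z : ℝ → ℂ} {t : ℝ → ℝ} {I : Set ℝ} (hz : ContDiffOn ℝ ∞ z I)
    (ht : ContDiffOn ℝ ∞ t I) : ContDiffOn ℝ ∞ (fun u => toE3 (z u) (t u)) I := by
  refine contDiffOn_pi.2 fun i => ?_
  fin_cases i
  · exact Complex.reCLM.contDiff.comp_contDiffOn hz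
  · exact Complex.imCLM.contDiff.comp_contDiffOn hz
  · exact ht

/-! ### The explicit surfaces have constant mean curvature -/

section Explicit

variable {a b : ℝ}

/-- The generating curve of `explicitHelicoid`. -/
def explicitCurve (a b H u : ℝ) : E3 := (-2 * H)⁻¹ • toE3 (profile a b u) (height a b u)

theorem explicitHelicoid_eq {H : ℝ} (hH : H ≠ 0) (a b u v : ℝ) :
    explicitHelicoid a b H u v = helicoidalMotion (-c₁ a b / (2 * H)) v (explicitCurve a b H u) := by
  rw [explicitCurve, smul_toE3, helicoidalMotion_toE3, explicitHelicoid, horizontalPart_eq,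
    verticalPart_eq]
  change (-2 * H)⁻¹ • toE3 _ _ = _
  rw [smul_toE3]
  congr 1
  · ring
  · field_simp
    ring

/-- The derivative of `heightDeriv`. -/
def heightDeriv₂ (a b u : ℝ) : ℝ :=
  -((profileDeriv a b u).re * (profile a b u).re + (profileDeriv a b u).im * (profile a b u).im)

theorem hasDerivAt_normSq {f : ℝ → ℂ} {f' : ℂ} {u : ℝ} (hf : HasDerivAt f f' u) :
    HasDerivAt (fun s => ((f s).re ^ 2 + (f s).im ^ 2) / 2)
      (f'.re * (f u).re + f'.im * (f u).im) u := by
  have hre : HasDerivAt (fun s => (f s).re) f'.re u :=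
    Complex.reCLM.hasFDerivAt.comp_hasDerivAt u hf
  have him : HasDerivAt (fun s => (f s).im) f'.im u :=
    Complex.imCLM.hasFDerivAt.comp_hasDerivAt u hf
  refine (((hre.pow 2).add (him.pow 2)).div_const 2).congr_deriv ?_
  simp only [Nat.cast_ofNat, Nat.add_one_sub_one, pow_one]
  ring

theorem hasDerivAt_heightDeriv (h : IsAdmissible a b) (u : ℝ) :
    HasDerivAt (heightDeriv a b) (heightDeriv₂ a b u) u := by
  rw [show heightDeriv a b = fun u => (a ^ 2 * b ^ 2 - 1) / 2
    - ((profile a b u).re ^ 2 + (profile a b u).im ^ 2) / 2 from funext (heightDeriv_eq h)]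
  exact (hasDerivAt_normSq (hasDerivAt_profile h u)).const_sub _

theorem hasDerivAt_explicitCurve (h : IsAdmissible a b) (H u : ℝ) :
    HasDerivAt (explicitCurve a b H)
      ((-2 * H)⁻¹ • toE3 (profileDeriv a b u) (heightDeriv a b u)) u :=
  (hasDerivAt_toE3 (hasDerivAt_profile h u) (hasDerivAt_height h u)).const_smul (-2 * H)⁻¹

theorem deriv_explicitCurve (h : IsAdmissible a b) (H : ℝ) :
    deriv (explicitCurve a b H)
      = fun u => (-2 * H)⁻¹ • toE3 (profileDeriv a b u) (heightDeriv a b u) :=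
  funext fun u => (hasDerivAt_explicitCurve h H u).deriv

theorem deriv_deriv_explicitCurve (h : IsAdmissible a b) (H u : ℝ) :
    deriv (deriv (explicitCurve a b H)) u
      = (-2 * H)⁻¹ • toE3 ((1 + heightDeriv a b u) * profile a b u
          + Complex.I * c₁ a b * profileDeriv a b u) (heightDeriv₂ a b u) := by
  rw [deriv_explicitCurve h]
  exact ((hasDerivAt_toE3 (hasDerivAt_profileDeriv h u)
    (hasDerivAt_heightDeriv h u)).const_smul (-2 * H)⁻¹).deriv

theorem contDiff_explicitCurve (h : IsAdmissible a b) (H : ℝ) :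
    ContDiffOn ℝ ∞ (explicitCurve a b H) univ :=
  (contDiffOn_const (c := (-2 * H)⁻¹)).smul
    (contDiffOn_toE3 (contDiff_profile h).contDiffOn (contDiff_height h).contDiffOn)

theorem axisField_explicitCurve {H : ℝ} (hH : H ≠ 0) (a b u : ℝ) :
    axisField (-c₁ a b / (2 * H)) (explicitCurve a b H u)
      = (-2 * H)⁻¹ • toE3 (Complex.I * profile a b u) (c₁ a b) := by
  rw [explicitCurve, smul_toE3, axisField_toE3, smul_toE3]
  congr 1
  · ring
  · field_simp

/-- The conformal factor of `explicitHelicoid`. -/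
def explicitFactor (a b H u : ℝ) : ℝ :=
  ((-2 * H)⁻¹) ^ 2 * ((profile a b u).re ^ 2 + (profile a b u).im ^ 2 + c₁ a b ^ 2)

theorem explicitFactor_pos (h : IsAdmissible a b) {H : ℝ} (hH : H ≠ 0) (u : ℝ) :
    0 < explicitFactor a b H u :=
  mul_pos (by positivity) (normSq_profile_add_c₁_sq_pos h u)

theorem explicit_conformal (h : IsAdmissible a b) {H : ℝ} (hH : H ≠ 0) (u : ℝ) :
    deriv (explicitCurve a b H) u ⬝ᵥ deriv (explicitCurve a b H) u = explicitFactor a b H u ∧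
    axisField (-c₁ a b / (2 * H)) (explicitCurve a b H u)
      ⬝ᵥ axisField (-c₁ a b / (2 * H)) (explicitCurve a b H u) = explicitFactor a b H u ∧
    deriv (explicitCurve a b H) u
      ⬝ᵥ axisField (-c₁ a b / (2 * H)) (explicitCurve a b H u) = 0 := by
  have h1 := normSq_profileDeriv h u
  have h2 := im_profileDeriv_mul_conj h u
  rw [axisField_explicitCurve hH, deriv_explicitCurve h, explicitFactor]
  simp only [smul_dotProduct, dotProduct_smul, dotProduct_toE3, smul_eq_mul, Complex.mul_re,
    Complex.mul_im, Complex.I_re, Complex.I_im]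
  refine ⟨?_, ?_, ?_⟩
  · linear_combination ((-2 * H)⁻¹) ^ 2 * h1
  · ring
  · linear_combination ((-2 * H)⁻¹) ^ 2 * h2

theorem isCmcHelicoid_explicit (h : IsAdmissible a b) {H : ℝ} (hH : H ≠ 0) :
    IsCmcHelicoid H (-c₁ a b / (2 * H)) univ (explicitHelicoid a b H) where
  ne_zero := hH
  isOpen := isOpen_univ
  isPreconnected := isPreconnected_univ
  helicoidal := ⟨explicitCurve a b H, contDiff_explicitCurve h H,
    fun u _ v => explicitHelicoid_eq hH a b u v⟩
  immersion u hu v h0 := by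
    obtain ⟨h1, h2, h3⟩ := explicit_conformal h hH u
    have h4 := normalDir_helicoid isOpen_univ (contDiff_explicitCurve h H)
      (fun u _ v => explicitHelicoid_eq hH a b u v) hu v
    have h5 := cross_dotProduct_cross_self h1 h2 h3
    rw [← helicoidalMotion_zero_dotProduct v, ← h4, h0, zero_dotProduct] at h5
    exact (pow_pos (explicitFactor_pos h hH u) 2).ne h5
  meanCurvature_eq u hu v := by
    obtain ⟨h1, h2, h3⟩ := explicit_conformal h hH u
    have hG := explicitFactor_pos h hH u
    rw [meanCurvature_helicoid isOpen_univ (contDiff_explicitCurve h H)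
      (fun u _ v => explicitHelicoid_eq hH a b u v) hu v]
    -- The explicit parameters are already isothermal, hence `p = 1` and `q = α = β = 0`.
    have h4 := traceQuotient_conformal (Z := deriv (deriv (explicitCurve a b H)) u)
      (R := axisField 0 (deriv (explicitCurve a b H) u))
      (S := axisField 0 (axisField (-c₁ a b / (2 * H)) (explicitCurve a b H u)))
      (q := 0) (α := 0) (β := 0) hG one_ne_zero h1 h2 h3
    -- The equation `Δx = 2H x_u × x_v`, at `v = 0`.
    have h5 : deriv (deriv (explicitCurve a b H)) u
        + axisField 0 (axisField (-c₁ a b / (2 * H)) (explicitCurve a b H u))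
        = (2 * H) • deriv (explicitCurve a b H) u
          ⨯₃ axisField (-c₁ a b / (2 * H)) (explicitCurve a b H u) := by
      rw [axisField_explicitCurve hH, deriv_deriv_explicitCurve h, deriv_explicitCurve h]
      simp only [map_smul, LinearMap.smul_apply, cross_toE3]
      rw [smul_toE3 _ (Complex.I * _), axisField_toE3, smul_toE3, toE3_add, smul_toE3,
        smul_toE3, smul_toE3]
      have hH' : (H : ℂ) ≠ 0 := by exact_mod_cast hH
      congr 1
      · push_cast
        field_simp
        linear_combination -profile a b u * Complex.I_sq
      · rw [heightDeriv₂]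
        field_simp
        ring
    rw [h5, smul_dotProduct, cross_dotProduct_cross_self h1 h2 h3] at h4
    simp only [one_smul, zero_smul, add_zero, one_pow, mul_zero, zero_mul, ne_eq, OfNat.ofNat_ne_zero,
      not_false_eq_true, zero_pow, abs_one, div_one, smul_eq_mul, one_mul] at h4
    rw [h4]
    field_simp

theorem isIsothermal_explicit (h : IsAdmissible a b) {H : ℝ} (hH : H ≠ 0) :
    IsIsothermal (explicitHelicoid a b H) := fun u v => by
  obtain ⟨h1, h2, h3⟩ := explicit_conformal h hH u
  rw [dU_eq isOpen_univ (contDiff_explicitCurve h H)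
      (fun u _ v => explicitHelicoid_eq hH a b u v) (mem_univ u),
    dV_eq (I := univ) (fun u _ v => explicitHelicoid_eq hH a b u v) (mem_univ u)]
  simp only [helicoidalMotion_zero_dotProduct]
  exact ⟨h1.trans h2.symm, h3⟩

theorem axisDist_explicit {H : ℝ} (hH : H ≠ 0) (a b u : ℝ) :
    axisDist (explicitHelicoid a b H) u
      = Real.sqrt (((-2 * H)⁻¹) ^ 2 * ((profile a b u).re ^ 2 + (profile a b u).im ^ 2)) := by
  rw [axisDist, explicitHelicoid_eq hH]
  congr 1
  simp [helicoidalMotion, explicitCurve, toE3]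
  ring

theorem explicitHelicoid_height {H : ℝ} (hH : H ≠ 0) (a b u : ℝ) :
    explicitHelicoid a b H u 0 2 = (-2 * H)⁻¹ * height a b u := by
  rw [explicitHelicoid_eq hH]
  simp [helicoidalMotion, explicitCurve, toE3]

end Explicit

/-! ### Unduloids and nodoids -/

section Delaunay

variable {a b : ℝ}

theorem jacobi_ellipticF (h : IsAdmissible a b) {θ : ℝ} (hθ : θ ∈ amRange (a / b)) :
    jacS a b (ellipticF θ (a / b) / b) = Real.sin θ ∧
    jacC a b (ellipticF θ (a / b) / b) = Real.cos θ ∧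
    jacB a b (ellipticF θ (a / b) / b) = b * Real.sqrt (1 - (a / b) ^ 2 * Real.sin θ ^ 2) := by
  have hb : b * (ellipticF θ (a / b) / b) = ellipticF θ (a / b) := by
    have := h.pos.ne'; field_simp
  have ham := am_ellipticF h.modulus_nonneg h.modulus_le_one hθ
  simp only [jacS, jacC, jacB, hb, dn, sn, cn, ham, and_self]

theorem isUnduloid_explicit (h : IsAdmissible a 1) (ha₀ : 0 < a) (ha : a < 1) {H : ℝ}
    (hH : H ≠ 0) : IsUnduloid H (explicitHelicoid a 1 H) := by
  refine ⟨?_, ?_, 0, ellipticF Real.pi (a / 1) / 1, ?_⟩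
  · have h1 := isCmcHelicoid_explicit h hH
    rwa [show c₁ a 1 = 0 by simp [c₁], neg_zero, zero_div] at h1
  -- For `b = 1` the derivative of the height is `-dn² - a cn dn = -((dn + a cn)² + 1 - a²)/2`. A
  -- uniform negative bound makes the height a bijection of the line.
  · have hle : ∀ u, heightDeriv a 1 u ≤ -((1 - a ^ 2) / 2) := fun u => by
      have hB := jacB_sq h u
      have hC := jacC_sq a 1 u
      rw [heightDeriv]
      nlinarith [sq_nonneg (jacB a 1 u + a * jacC a 1 u)]
    have hδ : 0 < (1 - a ^ 2) / 2 := by nlinarith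
    have hd := hasDerivAt_height h
    have hcont : Continuous (height a 1) :=
      continuous_iff_continuousAt.2 fun u => (hd u).continuousAt
    have hanti : StrictAnti (height a 1) :=
      strictAnti_of_deriv_neg fun u => by rw [(hd u).deriv]; linarith [hle u]
    have hd' : ∀ u, HasDerivAt (fun u => height a 1 u + (1 - a ^ 2) / 2 * u)
        (heightDeriv a 1 u + (1 - a ^ 2) / 2) u := fun u =>
      (hd u).add (hasDerivAt_const_mul_id _ u)
    have hanti' : Antitone fun u => height a 1 u + (1 - a ^ 2) / 2 * u :=
      antitone_of_deriv_nonpos (fun u => (hd' u).differentiableAt) fun u => by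
        rw [(hd' u).deriv]; linarith [hle u]
    have hsurj : Function.Surjective (height a 1) := by
      refine hcont.surjective' ?_ ?_
      · refine tendsto_atTop_mono' _ (f₁ := fun u => height a 1 0 + (-((1 - a ^ 2) / 2)) * u) ?_ ?_
        · filter_upwards [eventually_le_atBot 0] with u hu
          have := hanti' hu
          simp only [mul_zero, add_zero] at this
          linarith
        · exact tendsto_atTop_add_const_left _ _
            ((tendsto_const_mul_atTop_of_neg (by linarith)).2 tendsto_id)
      · refine tendsto_atBot_mono' _ (f₁ := fun u => height a 1 0 + (-((1 - a ^ 2) / 2)) * u) ?_ ?_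
        · filter_upwards [eventually_ge_atTop 0] with u hu
          have := hanti' hu
          simp only [mul_zero, add_zero] at this
          linarith
        · exact tendsto_atBot_add_const_left _ _
            ((tendsto_const_mul_atBot_of_neg (by linarith)).2 tendsto_id)
    have hmul : Function.Bijective fun t : ℝ => (-2 * H)⁻¹ * t :=
      mulLeft_bijective₀ _ (by simpa using hH)
    have hx : (fun u => explicitHelicoid a 1 H u 0 2) = (fun t => (-2 * H)⁻¹ * t) ∘ height a 1 :=
      funext fun u => explicitHelicoid_height hH a 1 u
    rw [hx]
    exact hmul.comp ⟨hanti.injective, hsurj⟩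
  -- At the amplitudes `0` and `π` the squared radii are `(1 + a)²` and `(1 - a)²`, up to scale.
  · obtain ⟨h1, h2, h3⟩ := jacobi_ellipticF h (θ := 0) (zero_mem_amRange _)
    obtain ⟨h4, h5, h6⟩ := jacobi_ellipticF h (θ := Real.pi)
      (mem_amRange_of_lt_one (h.modulus_lt_one ha) _)
    rw [ellipticF_zero, zero_div] at h1 h2 h3
    simp only [Real.sin_zero, Real.cos_zero, Real.sin_pi, Real.cos_pi] at h1 h2 h3 h4 h5 h6
    rw [axisDist_explicit hH, axisDist_explicit hH, normSq_profile h, normSq_profile h, h1, h2, h3,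
      h4, h5, h6]
    simp only [ne_eq, OfNat.ofNat_ne_zero, not_false_eq_true, zero_pow, mul_zero, sub_zero,
      Real.sqrt_one, mul_one, one_pow]
    rw [Real.sqrt_inj (mul_nonneg (sq_nonneg _) (by nlinarith))
      (mul_nonneg (sq_nonneg _) (by nlinarith [sq_nonneg (1 - a)]))]
    intro h0
    have := mul_left_cancel₀ (pow_ne_zero 2 (inv_ne_zero (by simpa using hH))) h0
    linarith

/-- The contribution of the elliptic integrals to the height of a nodoid, in terms of the
amplitude. -/
def nodoidIntegral (b θ : ℝ) : ℝ := (b ^ 2 - 1) * (ellipticF θ (1 / b) / b) - b * ellipticE θ (1 / b)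

theorem hasDerivAt_nodoidIntegral (hb : 1 < b) (θ : ℝ) :
    HasDerivAt (nodoidIntegral b)
      (-(Real.cos θ ^ 2 / (b * Real.sqrt (1 - (1 / b) ^ 2 * Real.sin θ ^ 2)))) θ := by
  have hb0 : 0 < b := by linarith
  have hk : 1 / b < 1 := (div_lt_one hb0).2 hb
  have hk0 : 0 ≤ 1 / b := by positivity
  have hmem := mem_amRange_of_lt_one hk θ
  refine ((((hasDerivAt_ellipticF hk0 hk.le hmem).div_const b).const_mul (b ^ 2 - 1)).sub
    ((hasDerivAt_ellipticE (1 / b) θ).const_mul b)).congr_deriv ?_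
  have hpos := sq_mul_sin_sq_lt_one hk0 hk.le hmem
  have hs := Real.sq_sqrt hpos.le
  have hs0 := Real.sqrt_pos.2 hpos
  set s := Real.sqrt (1 - (1 / b) ^ 2 * Real.sin θ ^ 2)
  have hs' : b ^ 2 * s ^ 2 = b ^ 2 - Real.sin θ ^ 2 := by rw [hs]; field_simp
  field_simp
  linear_combination -hs' + Real.sin_sq_add_cos_sq θ

/-- The derivative is invariant under `θ ↦ 2π - θ`, so the sum of the values at `θ` and `2π - θ` is
constant; it is evaluated at `π`. -/
theorem nodoidIntegral_reflect (hb : 1 < b) (θ : ℝ) :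
    nodoidIntegral b (2 * Real.pi - θ) = 2 * nodoidIntegral b Real.pi - nodoidIntegral b θ := by
  have hd : ∀ θ, HasDerivAt (fun θ => nodoidIntegral b (2 * Real.pi - θ) + nodoidIntegral b θ) 0 θ := by
    intro θ
    refine (((hasDerivAt_nodoidIntegral hb _).comp θ ((hasDerivAt_id θ).const_sub
      (2 * Real.pi))).add (hasDerivAt_nodoidIntegral hb θ)).congr_deriv ?_
    simp only [id, Real.sin_two_pi_sub, Real.cos_two_pi_sub, neg_sq]
    ring
  have := is_const_of_deriv_eq_zero (fun θ => (hd θ).differentiableAt) (fun θ => (hd θ).deriv) θ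
    Real.pi
  simp only [show 2 * Real.pi - Real.pi = Real.pi by ring] at this
  linarith

theorem height_ellipticF (hb : 1 < b) (θ : ℝ) :
    height 1 b (ellipticF θ (1 / b) / b) = -Real.sin θ + nodoidIntegral b θ := by
  have h : IsAdmissible 1 b := ⟨zero_le_one, le_rfl, hb.le⟩
  have hk : 1 / b < 1 := (div_lt_one h.pos).2 hb
  have hb' : b * (ellipticF θ (1 / b) / b) = ellipticF θ (1 / b) := by
    have := h.pos.ne'; field_simp
  rw [height, (jacobi_ellipticF h (mem_amRange_of_lt_one hk θ)).1, hb',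
    am_ellipticF h.modulus_nonneg hk.le (mem_amRange_of_lt_one hk θ), nodoidIntegral]
  ring

/-- Replacing `θ` by `2π - θ` preserves the radius and reflects the height in its value at `π`. A
point other than `π` with that same height is therefore a self-intersection. On `[π/2, π]` the
height increases strictly, so at `π/2` it is below its value at `π`; at `0` it is not below it,
because `nodoidIntegral` is antitone. The intermediate value theorem finds the point. -/
theorem exists_nodoid_crossing (hb : 1 < b) :
    ∃ θ ∈ Icc 0 (Real.pi / 2),
      -Real.sin θ + nodoidIntegral b θ = nodoidIntegral b Real.pi := by
  have hb0 : 0 < b := by linarith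
  have hd := hasDerivAt_nodoidIntegral hb
  have hd' : ∀ θ, HasDerivAt (fun θ => -Real.sin θ + nodoidIntegral b θ) _ θ := fun θ =>
    (Real.hasDerivAt_sin θ).neg.add (hd θ)
  have hcont : Continuous fun θ => -Real.sin θ + nodoidIntegral b θ :=
    continuous_iff_continuousAt.2 fun θ => (hd' θ).continuousAt
  have hanti : Antitone (nodoidIntegral b) :=
    antitone_of_deriv_nonpos (fun θ => (hd θ).differentiableAt) fun θ => by
      rw [(hd θ).deriv, neg_nonpos]; positivity
  have hmono : StrictMonoOn (fun θ => -Real.sin θ + nodoidIntegral b θ)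
      (Icc (Real.pi / 2) Real.pi) := by
    refine strictMonoOn_of_deriv_pos (convex_Icc _ _) hcont.continuousOn fun θ hθ => ?_
    rw [interior_Icc] at hθ
    rw [(hd' θ).deriv]
    have hcos : Real.cos θ < 0 :=
      Real.cos_neg_of_pi_div_two_lt_of_lt hθ.1 (by linarith [hθ.2, Real.pi_pos])
    -- With `b > 1` this bounds the negative term `cos² θ / (b √…)` strictly by `-cos θ`, the
    -- derivative of `-sin θ`.
    have hs : -Real.cos θ ≤ Real.sqrt (1 - (1 / b) ^ 2 * Real.sin θ ^ 2) := by
      refine Real.le_sqrt_of_sq_le ?_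
      have hk : (1 / b) ^ 2 ≤ 1 := pow_le_one₀ (by positivity) ((div_le_one hb0).2 hb.le)
      nlinarith [Real.sin_sq_add_cos_sq θ, sq_nonneg (Real.sin θ)]
    have h1 : Real.cos θ ^ 2 / (b * Real.sqrt (1 - (1 / b) ^ 2 * Real.sin θ ^ 2))
        < -Real.cos θ := by
      have h2 : -Real.cos θ < b * Real.sqrt (1 - (1 / b) ^ 2 * Real.sin θ ^ 2) := by nlinarith
      rw [div_lt_iff₀ (by linarith)]
      nlinarith
    linarith
  have h0 : nodoidIntegral b 0 = 0 := by simp [nodoidIntegral, ellipticF_zero, ellipticE_zero]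
  have hπ := Real.pi_pos
  have hlt := hmono (left_mem_Icc.2 (by linarith)) (right_mem_Icc.2 (by linarith))
    (show Real.pi / 2 < Real.pi by linarith)
  have hle := hanti hπ.le
  simp only [Real.sin_pi, neg_zero, zero_add] at hlt
  have := intermediate_value_Icc' (show (0 : ℝ) ≤ Real.pi / 2 by linarith) hcont.continuousOn
  exact this ⟨hlt.le, by simpa [h0] using hle⟩

theorem isNodoid_explicit (hb : 1 < b) {H : ℝ} (hH : H ≠ 0) :
    IsNodoid H (explicitHelicoid 1 b H) := by
  have h : IsAdmissible 1 b := ⟨zero_le_one, le_rfl, hb.le⟩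
  have hk : 1 / b < 1 := (div_lt_one h.pos).2 hb
  obtain ⟨θ, ⟨hθ₀, hθ₁⟩, hθ⟩ := exists_nodoid_crossing hb
  have hmem := mem_amRange_of_lt_one hk
  refine ⟨?_, ellipticF θ (1 / b) / b, ellipticF (2 * Real.pi - θ) (1 / b) / b, ?_, ?_, ?_⟩
  · have h1 := isCmcHelicoid_explicit h hH
    rwa [c₁_one, neg_zero, zero_div] at h1
  · refine (div_lt_div_of_pos_right ?_ h.pos).ne
    exact strictMonoOn_ellipticF h.modulus_nonneg hk.le (hmem _) (hmem _)
      (by linarith [Real.pi_pos])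
  · obtain ⟨h1, h2, h3⟩ := jacobi_ellipticF h (hmem θ)
    obtain ⟨h4, h5, h6⟩ := jacobi_ellipticF h (hmem (2 * Real.pi - θ))
    rw [axisDist_explicit hH, axisDist_explicit hH, normSq_profile h, normSq_profile h, h1, h2, h3,
      h4, h5, h6, Real.sin_two_pi_sub, Real.cos_two_pi_sub, neg_sq]
  · rw [explicitHelicoid_height hH, explicitHelicoid_height hH, height_ellipticF hb,
      height_ellipticF hb, hθ, nodoidIntegral_reflect hb, Real.sin_two_pi_sub]
    congr 1
    linarith

end Delaunay

/-! ### Reduction of an arbitrary helicoid to isothermal parameters -/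

/-- The curve `(f, h)` in `ℂ × ℝ`, with derivative `p (f₁, h₁)`, generates under the helicoidal
motions of pitch `l` a surface which is conformal and satisfies `Δx = -κ x_s × x_v` with respect to
the parameters `s = ∫ p` and `v`. -/
structure IsConformalCurve (κ l : ℝ) (I : Set ℝ) (p : ℝ → ℝ) (f f₁ : ℝ → ℂ) (h h₁ : ℝ → ℝ) :
    Prop where
  hasDerivAt_horiz : ∀ u ∈ I, HasDerivAt f (p u * f₁ u) u
  hasDerivAt_vert : ∀ u ∈ I, HasDerivAt h (p u * h₁ u) u
  hasDerivAt_horiz₁ : ∀ u ∈ I, HasDerivAt f₁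
    (p u * (f u + κ * (h₁ u * f u + Complex.I * l * f₁ u))) u
  hasDerivAt_vert₁ : ∀ u ∈ I, HasDerivAt h₁
    (p u * -(κ * ((f₁ u).re * (f u).re + (f₁ u).im * (f u).im))) u
  norm_eq : ∀ u ∈ I, (f₁ u).re ^ 2 + (f₁ u).im ^ 2 + h₁ u ^ 2 = (f u).re ^ 2 + (f u).im ^ 2 + l ^ 2
  orthogonal : ∀ u ∈ I, (f₁ u).im * (f u).re - (f₁ u).re * (f u).im + l * h₁ u = 0
  pos : ∀ u ∈ I, 0 < (f u).re ^ 2 + (f u).im ^ 2 + l ^ 2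

/-- The mean curvature equation in a conformal frame. -/
theorem conformal_equation {p q α β l H ε h₁ h₂ : ℝ} {f f₁ f₂ : ℂ} (hp : 0 < ε * p)
    (hε : ε = 1 ∨ ε = -1) (hG : 0 < f.re ^ 2 + f.im ^ 2 + l ^ 2)
    (hn : f₁.re ^ 2 + f₁.im ^ 2 + h₁ ^ 2 = f.re ^ 2 + f.im ^ 2 + l ^ 2)
    (ho : f₁.im * f.re - f₁.re * f.im + l * h₁ = 0)
    (hn' : f₂.re * f₁.re + f₂.im * f₁.im + h₂ * h₁ = f₁.re * f.re + f₁.im * f.im)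
    (ho' : f₂.im * f.re - f₂.re * f.im + l * h₂ = 0)
    (hH : traceQuotient (p • toE3 f₁ h₁ + q • toE3 (Complex.I * f) l) (toE3 (Complex.I * f) l)
      (p ^ 2 • toE3 f₂ h₂ + (2 * q * p) • toE3 (Complex.I * f₁) 0 + q ^ 2 • toE3 (-f) 0
        + α • toE3 f₁ h₁ + β • toE3 (Complex.I * f) l)
      (p • toE3 (Complex.I * f₁) 0 + q • toE3 (-f) 0) (toE3 (-f) 0) = H) :
    f₂ = f + (-2 * H * ε : ℝ) * (h₁ * f + Complex.I * l * f₁) ∧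
      h₂ = -((-2 * H * ε) * (f₁.re * f.re + f₁.im * f.im)) := by
  have hpε : p / |p| = ε := by
    rcases hε with rfl | rfl
    · have : 0 < p := by linarith
      rw [abs_of_pos this, div_self this.ne']
    · have : p < 0 := by linarith
      rw [abs_of_neg this, div_neg, div_self this.ne]
  have hε2 : ε * ε = 1 := by rcases hε with rfl | rfl <;> norm_num
  have hp0 : p ≠ 0 := by rintro rfl; simp at hp
  have hYY : toE3 f₁ h₁ ⬝ᵥ toE3 f₁ h₁ = f.re ^ 2 + f.im ^ 2 + l ^ 2 := by
    rw [dotProduct_toE3]; linear_combination hn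
  have hTT : toE3 (Complex.I * f) l ⬝ᵥ toE3 (Complex.I * f) l = f.re ^ 2 + f.im ^ 2 + l ^ 2 := by
    rw [dotProduct_toE3]; simp; ring
  have hYT : toE3 f₁ h₁ ⬝ᵥ toE3 (Complex.I * f) l = 0 := by
    rw [dotProduct_toE3]; simp; linear_combination ho
  rw [traceQuotient_conformal hG hp0 hYY hTT hYT, hpε] at hH
  -- The Laplacian is normal to the surface: orthogonality to the frame is exactly the
  -- differentiated conformality relations. The mean curvature then fixes its normal component.
  have hW := eq_smul_cross (W := toE3 f₂ h₂ + toE3 (-f) 0) hG hYY hTT hYT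
    (by rw [add_dotProduct, dotProduct_toE3, dotProduct_toE3]; simp; linear_combination hn')
    (by rw [add_dotProduct, dotProduct_toE3, dotProduct_toE3]; simp; linear_combination ho')
  have hk : (toE3 f₂ h₂ + toE3 (-f) 0) ⬝ᵥ toE3 f₁ h₁ ⨯₃ toE3 (Complex.I * f) l
      / (f.re ^ 2 + f.im ^ 2 + l ^ 2) ^ 2 = 2 * H * ε := by
    rw [← hH]
    generalize (toE3 f₂ h₂ + toE3 (-f) 0) ⬝ᵥ toE3 f₁ h₁ ⨯₃ toE3 (Complex.I * f) l = D
    field_simp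
    linear_combination -D * hε2
  rw [hk, cross_toE3, toE3_add, smul_toE3] at hW
  have e0 := congrFun hW 0
  have e1 := congrFun hW 1
  have e2 := congrFun hW 2
  simp only [toE3, Matrix.cons_val] at e0 e1 e2
  refine ⟨?_, by linarith⟩
  apply Complex.ext
  · simp at e0 ⊢; linear_combination e0
  · simp at e1 ⊢; linear_combination e1

/-- The speed of the isothermal parameter and the speed of the angle, for the curve `(w, z)`. -/
theorem conformal_algebra {w w' e : ℂ} {z' l p q G : ℝ} (he : e.re ^ 2 + e.im ^ 2 = 1)
    (hG : G = w.re ^ 2 + w.im ^ 2 + l ^ 2) (hp0 : p ≠ 0)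
    (hq : q * G = w'.im * w.re - w'.re * w.im + l * z')
    (hp : p ^ 2 * G = w'.re ^ 2 + w'.im ^ 2 + z' ^ 2 - q ^ 2 * G) :
    (e * (w' - Complex.I * q * w) / p).re ^ 2 + (e * (w' - Complex.I * q * w) / p).im ^ 2
        + ((z' - l * q) / p) ^ 2 = G ∧
      (e * (w' - Complex.I * q * w) / p).im * (e * w).re
        - (e * (w' - Complex.I * q * w) / p).re * (e * w).im + l * ((z' - l * q) / p) = 0 ∧
      (e * w).re ^ 2 + (e * w).im ^ 2 + l ^ 2 = G := by
  simp only [Complex.div_ofReal_re, Complex.div_ofReal_im, Complex.mul_re, Complex.mul_im,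
    Complex.sub_re, Complex.sub_im, Complex.I_re, Complex.I_im, Complex.ofReal_re,
    Complex.ofReal_im]
  refine ⟨?_, ?_, ?_⟩
  · field_simp
    linear_combination ((w'.re + q * w.im) ^ 2 + (w'.im - q * w.re) ^ 2) * he
      + 2 * q * hq - hp - q ^ 2 * hG
  · field_simp
    linear_combination (w'.im * w.re - w'.re * w.im - q * (w.re ^ 2 + w.im ^ 2)) * he - hq
      + q * hG
  · linear_combination (w.re ^ 2 + w.im ^ 2) * he - hG

theorem contDiffOn_of_hasDerivAt {F : Type*} [NormedAddCommGroup F] [NormedSpace ℝ F]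
    {f f' : ℝ → F} {I : Set ℝ} (hI : IsOpen I) (hd : ∀ u ∈ I, HasDerivAt f (f' u) u)
    (hf' : ContDiffOn ℝ ∞ f' I) : ContDiffOn ℝ ∞ f I :=
  (contDiffOn_infty_iff_deriv_of_isOpen hI).2
    ⟨fun u hu => (hd u hu).differentiableAt.differentiableWithinAt,
      hf'.congr fun u hu => (hd u hu).deriv⟩

theorem exists_antideriv {I : Set ℝ} (hI : IsOpen I) (hI' : IsPreconnected I) {u₀ : ℝ}
    (hu₀ : u₀ ∈ I) {p : ℝ → ℝ} (hp : ContDiffOn ℝ ∞ p I) :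
    ∃ φ : ℝ → ℝ, φ u₀ = 0 ∧ (∀ u ∈ I, HasDerivAt φ (p u) u) ∧ ContDiffOn ℝ ∞ φ I := by
  have hd : ∀ u ∈ I, HasDerivAt (fun u => ∫ t in u₀..u, p t) (p u) u := fun u hu =>
    hasDerivAt_integral_of_continuousOn hI hI'.ordConnected hp.continuousOn hu₀ hu
  exact ⟨_, by simp, hd, contDiffOn_of_hasDerivAt hI hd hp⟩

section Rotated

variable {I : Set ℝ} {w f f₁ : ℝ → ℂ} {z h h₁ φ ψ p q : ℝ → ℝ} {l : ℝ}

theorem hasDerivAt_exp_neg {u : ℝ} (hψ : HasDerivAt ψ (q u) u) :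
    HasDerivAt (fun u => Complex.exp (-(Complex.I * ψ u)))
      (-(Complex.I * q u) * Complex.exp (-(Complex.I * ψ u))) u := by
  refine (hψ.ofReal_comp.const_mul Complex.I).neg.cexp.congr_deriv ?_
  simp only [Pi.neg_apply]
  ring

/-- The second derivative of the curve, unrolled by the angle `ψ` and with respect to the
parameter `∫ p`. -/
def rotatedSecond (w f f₁ : ℝ → ℂ) (ψ p q : ℝ → ℝ) (u : ℝ) : ℂ :=
  (Complex.exp (-(Complex.I * ψ u)) * deriv (deriv w) u - 2 * q u * p u * (Complex.I * f₁ u)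
    + q u ^ 2 * f u - deriv p u * f₁ u - deriv q u * (Complex.I * f u)) / p u ^ 2

theorem hasDerivAt_rotated (hI : IsOpen I) (hw : ContDiffOn ℝ ∞ w I) (hp : ContDiffOn ℝ ∞ p I)
    (hq : ContDiffOn ℝ ∞ q I) (hψ : ∀ u ∈ I, HasDerivAt ψ (q u) u) (hp0 : ∀ u ∈ I, p u ≠ 0)
    (hf : f = fun u => Complex.exp (-(Complex.I * ψ u)) * w u)
    (hf₁ : f₁ = fun u => Complex.exp (-(Complex.I * ψ u))
      * (deriv w u - Complex.I * q u * w u) / p u)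
    {u : ℝ} (hu : u ∈ I) :
    HasDerivAt f (p u * f₁ u) u ∧
      HasDerivAt f₁ (p u * rotatedSecond w f f₁ ψ p q u) u := by
  have hpc : (p u : ℂ) ≠ 0 := by exact_mod_cast hp0 u hu
  have he := hasDerivAt_exp_neg (hψ u hu)
  have hw1 := hasDerivAt_of_contDiffOn hI hw hu
  have hw2 := hasDerivAt_of_contDiffOn hI (contDiffOn_deriv hI hw) hu
  have hq1 := (hasDerivAt_of_contDiffOn hI hq hu).ofReal_comp
  have hp1 := (hasDerivAt_of_contDiffOn hI hp hu).ofReal_comp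
  constructor
  · rw [hf]
    refine (he.mul hw1).congr_deriv ?_
    simp only [hf₁]
    field_simp
    ring
  · conv => enter [1]; rw [hf₁]
    refine ((he.mul (hw2.sub ((hq1.const_mul Complex.I).mul hw1))).div hp1 hpc).congr_deriv ?_
    simp only [rotatedSecond, hf₁, hf, Pi.mul_apply, Pi.sub_apply]
    field_simp
    ring_nf
    simp only [Complex.I_sq]
    ring

theorem hasDerivAt_rotated_vert (hI : IsOpen I) (hz : ContDiffOn ℝ ∞ z I)
    (hp : ContDiffOn ℝ ∞ p I) (hq : ContDiffOn ℝ ∞ q I) (hψ : ∀ u ∈ I, HasDerivAt ψ (q u) u)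
    (hp0 : ∀ u ∈ I, p u ≠ 0) {u : ℝ} (hu : u ∈ I) :
    HasDerivAt (fun u => z u - l * ψ u) (p u * ((deriv z u - l * q u) / p u)) u ∧
      HasDerivAt (fun u => (deriv z u - l * q u) / p u)
        (p u * ((deriv (deriv z) u - deriv p u * ((deriv z u - l * q u) / p u) - deriv q u * l)
          / p u ^ 2)) u := by
  have hpc := hp0 u hu
  have hz1 := hasDerivAt_of_contDiffOn hI hz hu
  have hz2 := hasDerivAt_of_contDiffOn hI (contDiffOn_deriv hI hz) hu
  have hq1 := hasDerivAt_of_contDiffOn hI hq hu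
  have hp1 := hasDerivAt_of_contDiffOn hI hp hu
  constructor
  · refine (hz1.sub ((hψ u hu).const_mul l)).congr_deriv ?_
    field_simp
  · refine ((hz2.sub (hq1.const_mul l)).div hp1 hpc).congr_deriv ?_
    simp only [Pi.sub_apply]
    field_simp
    ring

end Rotated

/-- Differentiating the conformality relations. -/
theorem conformal_deriv {I : Set ℝ} {p : ℝ → ℝ} {f f₁ f₂ : ℝ → ℂ} {h₁ h₂ : ℝ → ℝ} {l : ℝ}
    (hI : IsOpen I) (hp0 : ∀ u ∈ I, p u ≠ 0)
    (hf : ∀ u ∈ I, HasDerivAt f (p u * f₁ u) u) (hf₁ : ∀ u ∈ I, HasDerivAt f₁ (p u * f₂ u) u)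
    (hh₁ : ∀ u ∈ I, HasDerivAt h₁ (p u * h₂ u) u)
    (hn : ∀ u ∈ I,
      (f₁ u).re ^ 2 + (f₁ u).im ^ 2 + h₁ u ^ 2 = (f u).re ^ 2 + (f u).im ^ 2 + l ^ 2)
    (ho : ∀ u ∈ I, (f₁ u).im * (f u).re - (f₁ u).re * (f u).im + l * h₁ u = 0)
    {u : ℝ} (hu : u ∈ I) :
    (f₂ u).re * (f₁ u).re + (f₂ u).im * (f₁ u).im + h₂ u * h₁ u
        = (f₁ u).re * (f u).re + (f₁ u).im * (f u).im ∧
      (f₂ u).im * (f u).re - (f₂ u).re * (f u).im + l * h₂ u = 0 := by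
  have hre : ∀ {g : ℝ → ℂ} {g' : ℂ}, HasDerivAt g g' u → HasDerivAt (fun s => (g s).re) g'.re u :=
    fun hg => Complex.reCLM.hasFDerivAt.comp_hasDerivAt u hg
  have him : ∀ {g : ℝ → ℂ} {g' : ℂ}, HasDerivAt g g' u → HasDerivAt (fun s => (g s).im) g'.im u :=
    fun hg => Complex.imCLM.hasFDerivAt.comp_hasDerivAt u hg
  have hnhds := hI.mem_nhds hu
  have a1 := hre (hf u hu)
  have a2 := him (hf u hu)
  have a3 := hre (hf₁ u hu)
  have a4 := him (hf₁ u hu)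
  have a5 := hh₁ u hu
  simp only [Complex.re_ofReal_mul, Complex.im_ofReal_mul] at a1 a2 a3 a4
  constructor
  · have d1 := ((a3.pow 2).add (a4.pow 2)).add (a5.pow 2)
    have d2 := ((a1.pow 2).add (a2.pow 2)).add_const (l ^ 2)
    have d3 := d1.unique (d2.congr_of_eventuallyEq (by filter_upwards [hnhds] with s hs using hn s hs))
    simp only [Nat.cast_ofNat, Nat.add_one_sub_one, pow_one] at d3
    refine mul_left_cancel₀ (hp0 u hu) ?_
    linear_combination d3 / 2
  · have d1 := ((a4.mul a1).sub (a3.mul a2)).add (a5.const_mul l)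
    have d3 := d1.unique ((hasDerivAt_const u (0 : ℝ)).congr_of_eventuallyEq
      (by filter_upwards [hnhds] with s hs using ho s hs))
    refine mul_left_cancel₀ (hp0 u hu) ?_
    linear_combination d3

/-- Sliding the generating curve along the orbits, by the motion of angle `-ψ(u)`, gives the same
surface with `v` shifted by `ψ`. Choosing `ψ' = F/G` makes the curve orthogonal to the orbits, and
measuring its length in units of `√G` makes the parameters isothermal. -/
theorem exists_isConformalCurve {H l : ℝ} {I : Set ℝ} {x : ℝ → ℝ → E3}
    (hx : IsCmcHelicoid H l I x) {u₀ : ℝ} (hu₀ : u₀ ∈ I) {ε : ℝ} (hε : ε = 1 ∨ ε = -1) :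
    ∃ (p φ ψ : ℝ → ℝ) (f f₁ : ℝ → ℂ) (h h₁ : ℝ → ℝ),
      φ u₀ = 0 ∧ ContDiffOn ℝ ∞ φ I ∧ ContDiffOn ℝ ∞ ψ I ∧ ContinuousOn p I ∧
      (∀ u ∈ I, HasDerivAt φ (p u) u) ∧ (∀ u ∈ I, 0 < ε * p u) ∧
      IsConformalCurve (-2 * H * ε) l I p f f₁ h h₁ ∧
      ∀ u ∈ I, ∀ v, x u v = helicoidalMotion l (v + ψ u) (toE3 (f u) (h u)) := by
  obtain ⟨c, hc, hxc⟩ := hx.helicoidal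
  have hI := hx.isOpen
  have hci := contDiffOn_pi.1 hc
  obtain ⟨w, hwdef⟩ : ∃ w : ℝ → ℂ, w = fun u => (c u 0 : ℂ) + c u 1 * Complex.I := ⟨_, rfl⟩
  obtain ⟨z, hzdef⟩ : ∃ z : ℝ → ℝ, z = fun u => c u 2 := ⟨_, rfl⟩
  have hcwz : c = fun u => toE3 (w u) (z u) := by
    funext u; ext i; fin_cases i <;> simp [toE3, hwdef, hzdef]
  have hw : ContDiffOn ℝ ∞ w I := by
    rw [hwdef]
    exact (Complex.ofRealCLM.contDiff.comp_contDiffOn (hci 0)).add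
      ((Complex.ofRealCLM.contDiff.comp_contDiffOn (hci 1)).mul contDiffOn_const)
  have hz : ContDiffOn ℝ ∞ z I := by rw [hzdef]; exact hci 2
  have hw' := contDiffOn_deriv hI hw
  have hz' := contDiffOn_deriv hI hz
  have hre : ∀ {g : ℝ → ℂ}, ContDiffOn ℝ ∞ g I → ContDiffOn ℝ ∞ (fun u => (g u).re) I :=
    fun hg => Complex.reCLM.contDiff.comp_contDiffOn hg
  have him : ∀ {g : ℝ → ℂ}, ContDiffOn ℝ ∞ g I → ContDiffOn ℝ ∞ (fun u => (g u).im) I :=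
    fun hg => Complex.imCLM.contDiff.comp_contDiffOn hg
  have hdc : ∀ u ∈ I, deriv c u = toE3 (deriv w u) (deriv z u) := fun u hu => by
    rw [hcwz]
    exact (hasDerivAt_toE3 (hasDerivAt_of_contDiffOn hI hw hu)
      (hasDerivAt_of_contDiffOn hI hz hu)).deriv
  have hddc : ∀ u ∈ I, deriv (deriv c) u = toE3 (deriv (deriv w) u) (deriv (deriv z) u) :=
    fun u hu => by
      refine ((hasDerivAt_toE3 (hasDerivAt_of_contDiffOn hI hw' hu)
        (hasDerivAt_of_contDiffOn hI hz' hu)).congr_of_eventuallyEq ?_).deriv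
      filter_upwards [hI.mem_nhds hu] with s hs using hdc s hs
  obtain ⟨G, hGdef⟩ : ∃ G : ℝ → ℝ, G = fun u => (w u).re ^ 2 + (w u).im ^ 2 + l ^ 2 := ⟨_, rfl⟩
  obtain ⟨F, hFdef⟩ : ∃ F : ℝ → ℝ, F = fun u =>
    (deriv w u).im * (w u).re - (deriv w u).re * (w u).im + l * deriv z u := ⟨_, rfl⟩
  obtain ⟨E, hEdef⟩ : ∃ E : ℝ → ℝ, E = fun u =>
    (deriv w u).re ^ 2 + (deriv w u).im ^ 2 + deriv z u ^ 2 := ⟨_, rfl⟩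
  have hGs : ContDiffOn ℝ ∞ G I := by
    rw [hGdef]; exact (((hre hw).pow 2).add ((him hw).pow 2)).add contDiffOn_const
  have hFs : ContDiffOn ℝ ∞ F I := by
    rw [hFdef]
    exact (((him hw').mul (hre hw)).sub ((hre hw').mul (him hw))).add (contDiffOn_const.mul hz')
  have hEs : ContDiffOn ℝ ∞ E I := by
    rw [hEdef]; exact (((hre hw').pow 2).add ((him hw').pow 2)).add (hz'.pow 2)
  -- By Lagrange's identity this is the squared length of `x_u × x_v`.
  have hdisc : ∀ u ∈ I, 0 < E u * G u - F u ^ 2 := fun u hu => by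
    have h0 := hx.immersion u hu 0
    rw [normalDir_helicoid hI hc hxc hu, hdc u hu, hcwz] at h0
    have h1 : toE3 (deriv w u) (deriv z u) ⨯₃ axisField l (toE3 (w u) (z u)) ≠ 0 := by
      intro h2
      apply h0
      simp only [h2]
      ext i; fin_cases i <;> simp [helicoidalMotion]
    have h2 : 0 < toE3 (deriv w u) (deriv z u) ⨯₃ axisField l (toE3 (w u) (z u)) ⬝ᵥ
        toE3 (deriv w u) (deriv z u) ⨯₃ axisField l (toE3 (w u) (z u)) :=
      lt_of_le_of_ne (Finset.sum_nonneg fun i _ => mul_self_nonneg _)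
        fun h3 => h1 (dotProduct_self_eq_zero.1 h3.symm)
    rw [cross_dot_cross, axisField_toE3] at h2
    simp only [dotProduct_toE3] at h2
    convert h2 using 1
    simp [hEdef, hFdef, hGdef]
    ring
  have hGpos : ∀ u ∈ I, 0 < G u := fun u hu => by
    have h1 := hdisc u hu
    have h2 : 0 ≤ G u := by rw [hGdef]; positivity
    rcases h2.lt_or_eq with h3 | h3
    · exact h3
    · rw [← h3] at h1; nlinarith [sq_nonneg (F u)]
  have hε2 : ε ^ 2 = 1 := by rcases hε with rfl | rfl <;> norm_num
  -- `q` is the coefficient of the projection of `x_u` onto `x_v`; `|p|` is the length of the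
  -- orthogonal remainder divided by `√G`, and `ε` orients the new parameter.
  obtain ⟨q, hqdef⟩ : ∃ q : ℝ → ℝ, q = fun u => F u / G u := ⟨_, rfl⟩
  obtain ⟨p, hpdef⟩ : ∃ p : ℝ → ℝ, p = fun u => ε * Real.sqrt (E u * G u - F u ^ 2) / G u :=
    ⟨_, rfl⟩
  have hqs : ContDiffOn ℝ ∞ q I := by
    rw [hqdef]; exact hFs.div hGs fun u hu => (hGpos u hu).ne'
  have hps : ContDiffOn ℝ ∞ p I := by
    rw [hpdef]
    exact (contDiffOn_const.mul (((hEs.mul hGs).sub (hFs.pow 2)).sqrt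
      fun u hu => (hdisc u hu).ne')).div hGs fun u hu => (hGpos u hu).ne'
  have hεp : ∀ u ∈ I, 0 < ε * p u := fun u hu => by
    have h1 : ε * p u = ε ^ 2 * (Real.sqrt (E u * G u - F u ^ 2) / G u) := by rw [hpdef]; ring
    rw [h1, hε2, one_mul]
    exact div_pos (Real.sqrt_pos.2 (hdisc u hu)) (hGpos u hu)
  have hp0 : ∀ u ∈ I, p u ≠ 0 := fun u hu h0 => by
    have := hεp u hu; rw [h0, mul_zero] at this; exact this.false
  have hqG : ∀ u ∈ I, q u * G u = F u := fun u hu => by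
    have := (hGpos u hu).ne'; rw [hqdef]; field_simp
  have hpG : ∀ u ∈ I, p u ^ 2 * G u = E u - q u ^ 2 * G u := fun u hu => by
    have := (hGpos u hu).ne'
    simp only [hpdef, hqdef, mul_pow, div_pow, hε2, Real.sq_sqrt (hdisc u hu).le]
    field_simp
  obtain ⟨φ, hφ0, hφ, hφs⟩ := exists_antideriv hI hx.isPreconnected hu₀ hps
  obtain ⟨ψ, -, hψ, hψs⟩ := exists_antideriv hI hx.isPreconnected hu₀ hqs
  obtain ⟨f, hf⟩ : ∃ f : ℝ → ℂ, f = fun u => Complex.exp (-(Complex.I * ψ u)) * w u := ⟨_, rfl⟩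
  obtain ⟨f₁, hf₁⟩ : ∃ f₁ : ℝ → ℂ, f₁ = fun u => Complex.exp (-(Complex.I * ψ u))
      * (deriv w u - Complex.I * q u * w u) / p u := ⟨_, rfl⟩
  obtain ⟨h₁, hh₁⟩ : ∃ h₁ : ℝ → ℝ, h₁ = fun u => (deriv z u - l * q u) / p u := ⟨_, rfl⟩
  obtain ⟨h₂, hh₂⟩ : ∃ h₂ : ℝ → ℝ, h₂ = fun u =>
    (deriv (deriv z) u - deriv p u * h₁ u - deriv q u * l) / p u ^ 2 := ⟨_, rfl⟩
  have hrot := fun u hu => hasDerivAt_rotated hI hw hps hqs hψ hp0 hf hf₁ (u := u) hu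
  have hrotv := fun u hu => hasDerivAt_rotated_vert (l := l) hI hz hps hqs hψ hp0 (u := u) hu
  have hv₁ : ∀ u ∈ I, HasDerivAt h₁ (p u * h₂ u) u := fun u hu => by
    rw [hh₂, hh₁]; exact (hrotv u hu).2
  have hconf : ∀ u ∈ I, (f₁ u).re ^ 2 + (f₁ u).im ^ 2 + h₁ u ^ 2 = G u ∧
      (f₁ u).im * (f u).re - (f₁ u).re * (f u).im + l * h₁ u = 0 ∧
      (f u).re ^ 2 + (f u).im ^ 2 + l ^ 2 = G u := fun u hu => by
    have he : (Complex.exp (-(Complex.I * ψ u))).re ^ 2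
        + (Complex.exp (-(Complex.I * ψ u))).im ^ 2 = 1 := by
      have := normSq_exp_I_mul (-ψ u)
      push_cast at this
      rwa [mul_neg] at this
    rw [hf₁, hf, hh₁]
    refine conformal_algebra he (by rw [hGdef]) (hp0 u hu) ?_ ?_
    · rw [hqG u hu, hFdef]
    · rw [hpG u hu, hEdef]
  have hn : ∀ u ∈ I,
      (f₁ u).re ^ 2 + (f₁ u).im ^ 2 + h₁ u ^ 2 = (f u).re ^ 2 + (f u).im ^ 2 + l ^ 2 :=
    fun u hu => (hconf u hu).1.trans (hconf u hu).2.2.symm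
  have ho := fun u hu => (hconf u hu).2.1
  have hpos : ∀ u ∈ I, 0 < (f u).re ^ 2 + (f u).im ^ 2 + l ^ 2 := fun u hu => by
    rw [(hconf u hu).2.2]; exact hGpos u hu
  have hder := fun u hu => conformal_deriv hI hp0 (fun u hu => (hrot u hu).1)
    (fun u hu => (hrot u hu).2) hv₁ hn ho (u := u) hu
  have hwexp : ∀ u, w u = Complex.exp (Complex.I * ψ u) * f u := fun u => by
    rw [hf, ← mul_assoc, ← Complex.exp_add]; simp
  have heq : ∀ u ∈ I, rotatedSecond w f f₁ ψ p q u
        = f u + (-2 * H * ε : ℝ) * (h₁ u * f u + Complex.I * l * f₁ u) ∧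
      h₂ u = -((-2 * H * ε) * ((f₁ u).re * (f u).re + (f₁ u).im * (f u).im)) := fun u hu => by
    have hpc : (p u : ℂ) ≠ 0 := by exact_mod_cast hp0 u hu
    refine conformal_equation (q := q u) (α := deriv p u) (β := deriv q u) (hεp u hu) hε (hpos u hu)
      (hn u hu) (ho u hu) (hder u hu).1 (hder u hu).2 ?_
    have hH := hx.meanCurvature_eq u hu 0
    -- Rotating all the vectors by `-ψ(u)` expresses them through the slid curve, in the form that
    -- `conformal_equation` expects.
    rw [meanCurvature_helicoid hI hc hxc hu, ← traceQuotient_helicoidalMotion (-ψ u), hddc u hu,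
      hdc u hu, hcwz] at hH
    simp only [axisField_toE3, helicoidalMotion_toE3] at hH
    have hexp : Complex.exp (Complex.I * ((-ψ u : ℝ) : ℂ)) = Complex.exp (-(Complex.I * ψ u)) := by
      push_cast; rw [mul_neg]
    have hfu : f u = Complex.exp (-(Complex.I * ψ u)) * w u := by rw [hf]
    have hf₁u : Complex.exp (-(Complex.I * ψ u)) * deriv w u = p u * f₁ u + Complex.I * q u * f u := by
      simp only [hf₁, hf]; field_simp; ring
    have hzu : deriv z u = p u * h₁ u + l * q u := by
      have := hp0 u hu
      simp only [hh₁]; field_simp; ring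
    have hf₂u : Complex.exp (-(Complex.I * ψ u)) * deriv (deriv w) u
        = p u ^ 2 * rotatedSecond w f f₁ ψ p q u + 2 * q u * p u * (Complex.I * f₁ u)
          - q u ^ 2 * f u + deriv p u * f₁ u + deriv q u * (Complex.I * f u) := by
      simp only [rotatedSecond]; field_simp; ring
    have hz₂u : deriv (deriv z) u = p u ^ 2 * h₂ u + deriv p u * h₁ u + deriv q u * l := by
      have := hp0 u hu
      simp only [hh₂]; field_simp; ring
    rw [← hH, hexp]
    simp only [smul_toE3, toE3_add, mul_left_comm _ Complex.I, hf₁u, hf₂u, ← hfu, zero_mul,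
      add_zero, mul_zero]
    congr 2
    · ring
    · linarith
    · push_cast; ring
    · linarith
    · linear_combination -q u * f u * Complex.I_sq
    · linear_combination -f u * Complex.I_sq
  refine ⟨p, φ, ψ, f, f₁, fun u => z u - l * ψ u, h₁, hφ0, hφs, hψs, hps.continuousOn, hφ, hεp,
    ⟨fun u hu => (hrot u hu).1, fun u hu => ?_, fun u hu => ?_, fun u hu => ?_, hn, ho, hpos⟩, ?_⟩
  · rw [hh₁]; exact (hrotv u hu).1
  · rw [← (heq u hu).1]; exact (hrot u hu).2
  · rw [← (heq u hu).2]; exact hv₁ u hu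
  · intro u hu v
    rw [hxc u hu v, hcwz]
    simp only [helicoidalMotion_toE3]
    rw [hwexp u, ← mul_assoc, ← Complex.exp_add]
    congr 1
    · push_cast; ring_nf
    · ring

/-! ### Uniqueness for reparametrized autonomous equations -/

section Uniqueness

variable {F : Type*} [NormedAddCommGroup F] [NormedSpace ℝ F]

/-- Near `t` the field `V` is Lipschitz and the continuous factor `p` is bounded, so the local
uniqueness theorem applies to `p V`. -/
theorem eventuallyEq_of_hasDerivAt_smul {V : F → F} (hV : ContDiff ℝ 1 V) {I : Set ℝ}
    (hI : IsOpen I) {p : ℝ → ℝ} (hp : ContinuousOn p I) {y₁ y₂ : ℝ → F}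
    (h₁ : ∀ u ∈ I, HasDerivAt y₁ (p u • V (y₁ u)) u)
    (h₂ : ∀ u ∈ I, HasDerivAt y₂ (p u • V (y₂ u)) u) {t : ℝ} (ht : t ∈ I) (heq : y₁ t = y₂ t) :
    y₁ =ᶠ[𝓝 t] y₂ := by
  obtain ⟨K, s, hs, hK⟩ := hV.contDiffAt.exists_lipschitzOnWith (x := y₁ t)
  have hI' := hI.mem_nhds ht
  have hpt : ∀ᶠ u in 𝓝 t, ‖p u‖ < ‖p t‖ + 1 :=
    ((hp.continuousAt hI').norm).eventually_lt_const (lt_add_one _)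
  refine ODE_solution_unique_of_eventually (v := fun u y => p u • V y) (s := fun _ => s)
    (K := Real.toNNReal (‖p t‖ + 1) * K) ?_ ?_ ?_ heq
  · filter_upwards [hpt] with u hu
    refine LipschitzOnWith.of_dist_le_mul fun y hy y' hy' => ?_
    rw [dist_smul₀, NNReal.coe_mul, Real.coe_toNNReal _ (by positivity), mul_assoc]
    exact mul_le_mul hu.le (hK.dist_le_mul y hy y' hy') dist_nonneg (by positivity)
  · filter_upwards [hI', (h₁ t ht).continuousAt.preimage_mem_nhds hs] with u hu hus
    exact ⟨h₁ u hu, hus⟩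
  · rw [heq] at hs
    filter_upwards [hI', (h₂ t ht).continuousAt.preimage_mem_nhds hs] with u hu hus
    exact ⟨h₂ u hu, hus⟩

/-- The points near which the solutions agree form an open set. It is relatively closed, since at a
limit point the values agree by continuity and local uniqueness applies there. -/
theorem eqOn_of_hasDerivAt_smul {V : F → F} (hV : ContDiff ℝ 1 V) {I : Set ℝ} (hI : IsOpen I)
    (hI' : IsPreconnected I) {p : ℝ → ℝ} (hp : ContinuousOn p I) {y₁ y₂ : ℝ → F}
    (h₁ : ∀ u ∈ I, HasDerivAt y₁ (p u • V (y₁ u)) u)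
    (h₂ : ∀ u ∈ I, HasDerivAt y₂ (p u • V (y₂ u)) u) {t : ℝ} (ht : t ∈ I) (heq : y₁ t = y₂ t) :
    EqOn y₁ y₂ I := by
  have hsub : I ⊆ {u | y₁ =ᶠ[𝓝 u] y₂} := by
    refine hI'.subset_of_closure_inter_subset isOpen_setOfPred_eventually_nhds
      ⟨t, ht, eventuallyEq_of_hasDerivAt_smul hV hI hp h₁ h₂ ht heq⟩ ?_
    rintro u ⟨hu, huI⟩
    refine eventuallyEq_of_hasDerivAt_smul hV hI hp h₁ h₂ huI ?_
    have hcl : u ∈ closure {u | y₁ u = y₂ u} :=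
      closure_mono (fun s (hs : y₁ =ᶠ[𝓝 s] y₂) => hs.eq_of_nhds) hu
    have := mem_closure_iff_nhdsWithin_neBot.1 hcl
    exact tendsto_nhds_unique_of_eventuallyEq
      ((h₁ u huI).continuousAt.tendsto.mono_left nhdsWithin_le_nhds)
      ((h₂ u huI).continuousAt.tendsto.mono_left nhdsWithin_le_nhds) self_mem_nhdsWithin
  exact fun u hu => (hsub hu).eq_of_nhds

theorem eq_add_of_hasDerivAt {I : Set ℝ} (hI : IsOpen I) (hI' : IsPreconnected I) {f g f' : ℝ → ℝ}
    (hf : ∀ u ∈ I, HasDerivAt f (f' u) u) (hg : ∀ u ∈ I, HasDerivAt g (f' u) u) {u₀ : ℝ}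
    (hu₀ : u₀ ∈ I) : ∀ u ∈ I, f u = g u + (f u₀ - g u₀) := by
  intro u hu
  have hd : ∀ u ∈ I, HasDerivAt (fun u => f u - g u) 0 u := fun u hu =>
    ((hf u hu).sub (hg u hu)).congr_deriv (sub_self _)
  have := hI.is_const_of_deriv_eq_zero hI'
    (fun u hu => (hd u hu).differentiableAt.differentiableWithinAt) (fun u hu => (hd u hu).deriv)
    hu hu₀
  linarith

end Uniqueness

/-! ### Matching initial data and the classification -/

theorem IsConformalCurve.const_mul {κ l : ℝ} {I : Set ℝ} {p : ℝ → ℝ} {f f₁ : ℝ → ℂ} {h h₁ : ℝ → ℝ}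
    (hc : IsConformalCurve κ l I p f f₁ h h₁) (hκ : κ ≠ 0) :
    IsConformalCurve 1 (κ * l) I p (fun u => κ * f u) (fun u => κ * f₁ u) (fun u => κ * h u)
      (fun u => κ * h₁ u) where
  hasDerivAt_horiz u hu :=
    ((hc.hasDerivAt_horiz u hu).const_mul (κ : ℂ)).congr_deriv (by ring)
  hasDerivAt_vert u hu := ((hc.hasDerivAt_vert u hu).const_mul κ).congr_deriv (by ring)
  hasDerivAt_horiz₁ u hu :=
    ((hc.hasDerivAt_horiz₁ u hu).const_mul (κ : ℂ)).congr_deriv (by push_cast; ring)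
  hasDerivAt_vert₁ u hu :=
    ((hc.hasDerivAt_vert₁ u hu).const_mul κ).congr_deriv (by
      simp only [Complex.re_ofReal_mul, Complex.im_ofReal_mul]; ring)
  norm_eq u hu := by
    simp only [Complex.re_ofReal_mul, Complex.im_ofReal_mul]
    linear_combination κ ^ 2 * hc.norm_eq u hu
  orthogonal u hu := by
    simp only [Complex.re_ofReal_mul, Complex.im_ofReal_mul]
    linear_combination κ ^ 2 * hc.orthogonal u hu
  pos u hu := by
    simp only [Complex.re_ofReal_mul, Complex.im_ofReal_mul]
    have := mul_pos (sq_pos_of_ne_zero hκ) (hc.pos u hu)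
    linarith

/-- The two conditions give `a² + b² = L² + 1 + P²`, hence `(b ± a)² = L² + (1 ± P)²`. The square
roots `s = b + a` and `r = b - a` determine `a` and `b`. -/
theorem exists_admissible {L P : ℝ} (hL : 0 ≤ L) (hP : 0 ≤ P) :
    ∃ a b, IsAdmissible a b ∧ c₁ a b = L ∧ a * b = P := by
  have h1 : 0 ≤ L ^ 2 + (1 + P) ^ 2 := by positivity
  have h2 : 0 ≤ L ^ 2 + (1 - P) ^ 2 := by positivity
  have hle : Real.sqrt (L ^ 2 + (1 - P) ^ 2) ≤ Real.sqrt (L ^ 2 + (1 + P) ^ 2) :=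
    Real.sqrt_le_sqrt (by nlinarith)
  have hs1 := Real.sq_sqrt h1
  have hs2 := Real.sq_sqrt h2
  have hr := Real.sqrt_nonneg (L ^ 2 + (1 - P) ^ 2)
  set s := Real.sqrt (L ^ 2 + (1 + P) ^ 2)
  set r := Real.sqrt (L ^ 2 + (1 - P) ^ 2)
  have hab : (s - r) / 2 * ((s + r) / 2) = P := by linear_combination (hs1 - hs2) / 4
  have hc : (1 - ((s - r) / 2) ^ 2) * (((s + r) / 2) ^ 2 - 1) = L ^ 2 := by
    linear_combination (hs1 + hs2) / 2 - ((s - r) / 2 * ((s + r) / 2) + P) * hab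
  have ha : 0 ≤ (s - r) / 2 := by linarith
  have hle' : (s - r) / 2 ≤ (s + r) / 2 := by linarith
  generalize (s - r) / 2 = a at *
  generalize (s + r) / 2 = b at *
  -- Since `a ≤ b`, either `a > 1` or `b < 1` would make `(1 - a²)(b² - 1) = L²` negative.
  have ha1 : a ≤ 1 := by
    by_contra! hlt
    nlinarith [sq_nonneg L, mul_pos (show 0 < a ^ 2 - 1 by nlinarith)
      (show 0 < b ^ 2 - 1 by nlinarith)]
  have hb1 : 1 ≤ b := by
    by_contra! hlt
    nlinarith [sq_nonneg L, mul_pos (show 0 < 1 - a ^ 2 by nlinarith)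
      (show 0 < 1 - b ^ 2 by nlinarith)]
  exact ⟨a, b, ⟨ha, ha1, hb1⟩, by rw [c₁, hc, Real.sqrt_sq hL], hab⟩

/-- The squared distance from the axis takes all values between its extreme ones. -/
theorem exists_angle {a b ρ : ℝ} (h : IsAdmissible a b) (h₀ : (1 - a * b) ^ 2 ≤ ρ)
    (h₁ : ρ ≤ (1 + a * b) ^ 2) (hpos : 0 < ρ + c₁ a b ^ 2) :
    ∃ θ ∈ Icc 0 Real.pi, θ ∈ amRange (a / b) ∧ -θ ∈ amRange (a / b) ∧
      1 + a ^ 2 * b ^ 2 - 2 * a ^ 2 * Real.sin θ ^ 2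
        + 2 * a * (Real.cos θ * (b * Real.sqrt (1 - (a / b) ^ 2 * Real.sin θ ^ 2))) = ρ := by
  rcases h.modulus_le_one.lt_or_eq with hk | hk
  · have hcont : Continuous fun θ => 1 + a ^ 2 * b ^ 2 - 2 * a ^ 2 * Real.sin θ ^ 2
        + 2 * a * (Real.cos θ * (b * Real.sqrt (1 - (a / b) ^ 2 * Real.sin θ ^ 2))) := by fun_prop
    -- The function falls from `(1 + ab)²` at `0` to `(1 - ab)²` at `π`.
    obtain ⟨θ, hθ, hθρ⟩ := intermediate_value_Icc' Real.pi_pos.le hcont.continuousOn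
      (show ρ ∈ Icc _ _ from ⟨by simp; linarith, by simp; linarith⟩)
    exact ⟨θ, hθ, mem_amRange_of_lt_one hk _, mem_amRange_of_lt_one hk _, hθρ⟩
  -- Modulus 1 forces `a = b = 1`, the sphere without its poles. The squared radius is `4 cos² θ`
  -- with `|θ| < π/2`, so every value in `(0, 4]` occurs; zero is excluded by `hpos`.
  · have hab : a = b := by rwa [div_eq_one_iff_eq h.pos.ne'] at hk
    have hb1 : b = 1 := le_antisymm (hab ▸ h.le_one) h.one_le
    subst hb1
    subst hab
    rw [c₁_one] at hpos
    have hρ : 0 < ρ := by linarith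
    have hs := Real.sqrt_pos.2 hρ
    have hs2 := Real.sq_sqrt hρ.le
    have hle : Real.sqrt ρ / 2 ≤ 1 := by nlinarith
    have hlt : Real.arccos (Real.sqrt ρ / 2) < Real.pi / 2 :=
      Real.arccos_lt_pi_div_two.2 (by positivity)
    have hnn := Real.arccos_nonneg (Real.sqrt ρ / 2)
    have hcos := Real.cos_arccos (x := Real.sqrt ρ / 2) (by linarith) hle
    have hsin := Real.sin_sq_add_cos_sq (Real.arccos (Real.sqrt ρ / 2))
    have hπ := Real.pi_pos
    refine ⟨Real.arccos (Real.sqrt ρ / 2), ⟨hnn, by linarith⟩, ?_, ?_, ?_⟩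
    · simp only [amRange, div_one, lt_irrefl, if_false]
      exact ⟨by linarith, hlt⟩
    · simp only [amRange, div_one, lt_irrefl, if_false]
      exact ⟨by linarith, by linarith⟩
    · rw [show 1 - ((1 : ℝ) / 1) ^ 2 * Real.sin (Real.arccos (Real.sqrt ρ / 2)) ^ 2
        = Real.cos (Real.arccos (Real.sqrt ρ / 2)) ^ 2 by linear_combination -hsin,
        hcos, Real.sqrt_sq (by positivity)]
      rw [hcos] at hsin
      linear_combination -2 * hsin + hs2

/-- Two complex numbers with the same modulus and derivatives in the same relative position differ
by a rotation. -/
theorem exists_rotation {f f₁ g g₁ : ℂ} (hg : f.re ^ 2 + f.im ^ 2 = g.re ^ 2 + g.im ^ 2)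
    (hg₁ : f₁.re ^ 2 + f₁.im ^ 2 = g₁.re ^ 2 + g₁.im ^ 2)
    (hre : f₁.re * f.re + f₁.im * f.im = g₁.re * g.re + g₁.im * g.im)
    (him : f₁.im * f.re - f₁.re * f.im = g₁.im * g.re - g₁.re * g.im) :
    ∃ α : ℝ, f = Complex.exp (Complex.I * α) * g ∧ f₁ = Complex.exp (Complex.I * α) * g₁ := by
  have key : ∀ {z w : ℂ}, z.re ^ 2 + z.im ^ 2 = w.re ^ 2 + w.im ^ 2 →
      ∃ α : ℝ, z = Complex.exp (Complex.I * α) * w := by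
    intro z w hzw
    by_cases hw : w = 0
    · subst hw
      refine ⟨0, ?_⟩
      simp only [Complex.zero_re, Complex.zero_im] at hzw
      rw [mul_zero]
      apply Complex.ext <;> simp <;> nlinarith [sq_nonneg z.re, sq_nonneg z.im]
    · have hn : ‖z / w‖ = 1 := by
        rw [norm_div, div_eq_one_iff_eq (norm_ne_zero_iff.2 hw),
          ← sq_eq_sq₀ (norm_nonneg _) (norm_nonneg _), Complex.sq_norm, Complex.sq_norm,
          Complex.normSq_apply, Complex.normSq_apply]
        linarith
      obtain ⟨α, hα⟩ := (Complex.norm_eq_one_iff _).1 hn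
      exact ⟨α, by rw [mul_comm Complex.I, hα]; field_simp⟩
  by_cases hf : g = 0
  · obtain ⟨α, hα⟩ := key hg₁
    refine ⟨α, ?_, hα⟩
    subst hf
    simp only [Complex.zero_re, Complex.zero_im] at hg
    rw [mul_zero]
    apply Complex.ext <;> simp <;> nlinarith [sq_nonneg f.re, sq_nonneg f.im]
  · obtain ⟨α, hα⟩ := key hg
    refine ⟨α, hα, ?_⟩
    have he := normSq_exp_I_mul α
    generalize Complex.exp (Complex.I * α) = e at *
    subst hα
    have hgpos : g.re ^ 2 + g.im ^ 2 ≠ 0 := by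
      intro h0
      apply hf
      apply Complex.ext <;> simp <;> nlinarith [sq_nonneg g.re, sq_nonneg g.im]
    simp only [Complex.mul_re, Complex.mul_im] at hre him hg
    apply Complex.ext
    · rw [Complex.mul_re]
      refine mul_left_cancel₀ hgpos ?_
      linear_combination -f₁.re * hg + (e.re * g.re - e.im * g.im) * hre
        - (e.re * g.im + e.im * g.re) * him
    · rw [Complex.mul_im]
      refine mul_left_cancel₀ hgpos ?_
      linear_combination -f₁.im * hg + (e.re * g.im + e.im * g.re) * hre
        + (e.re * g.re - e.im * g.im) * him

/-- Given the constants, the radius determines the vertical velocity, the speed and the angular part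
of `f₁`, and the radial part up to sign. So it suffices to find a profile point of equal radius on
the half with the right sign; a rotation does the rest. -/
theorem exists_match {a b h₁ : ℝ} {f f₁ : ℂ} (h : IsAdmissible a b)
    (hn : f₁.re ^ 2 + f₁.im ^ 2 + h₁ ^ 2 = f.re ^ 2 + f.im ^ 2 + c₁ a b ^ 2)
    (ho : f₁.im * f.re - f₁.re * f.im + c₁ a b * h₁ = 0)
    (hpos : 0 < f.re ^ 2 + f.im ^ 2 + c₁ a b ^ 2)
    (hm : h₁ = (a ^ 2 * b ^ 2 - 1) / 2 - (f.re ^ 2 + f.im ^ 2) / 2)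
    (hle : h₁ ^ 2 ≤ f.re ^ 2 + f.im ^ 2) :
    ∃ s α : ℝ, f = Complex.exp (Complex.I * α) * profile a b s ∧
      f₁ = Complex.exp (Complex.I * α) * profileDeriv a b s := by
  obtain ⟨ρ, hρ⟩ : ∃ ρ, ρ = f.re ^ 2 + f.im ^ 2 := ⟨_, rfl⟩
  rw [← hρ] at hn hpos hm hle
  have hP : 0 ≤ a * b := mul_nonneg h.nonneg h.pos.le
  have hρ0 : 0 ≤ ρ := by rw [hρ]; positivity
  -- Substituting `hm` into `h₁² ≤ ρ` gives `(a²b² - 1 - ρ)² ≤ 4ρ`, which factors this way.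
  have hprod : 0 ≤ (ρ - (1 - a * b) ^ 2) * ((1 + a * b) ^ 2 - ρ) := by
    rw [hm] at hle; linarith
  have hlo : (1 - a * b) ^ 2 ≤ ρ := by
    by_contra! hlt
    nlinarith [mul_pos (sub_pos.2 hlt) (show 0 < (1 + a * b) ^ 2 - ρ by nlinarith)]
  have hhi : ρ ≤ (1 + a * b) ^ 2 := by
    by_contra! hlt
    nlinarith [mul_pos (sub_pos.2 hlt) (show 0 < ρ - (1 - a * b) ^ 2 by nlinarith)]
  obtain ⟨θ, hθ, hθ1, hθ2, hθρ⟩ := exists_angle h hlo hhi hpos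
  have hsin := Real.sin_nonneg_of_mem_Icc hθ
  have main : ∀ s, (profile a b s).re ^ 2 + (profile a b s).im ^ 2 = ρ →
      0 ≤ (f₁.re * f.re + f₁.im * f.im) * -(a * jacS a b s) →
      ∃ s α : ℝ, f = Complex.exp (Complex.I * α) * profile a b s ∧
      f₁ = Complex.exp (Complex.I * α) * profileDeriv a b s := by
    intro s hs hsign
    have e1 := normSq_profileDeriv h s
    have e2 := im_profileDeriv_mul_conj h s
    have e3 := re_profileDeriv_mul_conj h s
    have e4 := heightDeriv_eq h s
    rw [hs, ← hm] at e4
    rw [hs] at e1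
    rw [e4] at e1 e2
    refine ⟨s, ?_⟩
    refine exists_rotation (hρ.symm.trans hs.symm) (by linarith) ?_ (by linarith)
    have hsq : (f₁.re * f.re + f₁.im * f.im) ^ 2 = ((profileDeriv a b s).re * (profile a b s).re
        + (profileDeriv a b s).im * (profile a b s).im) ^ 2 := by
      have l1 : (f₁.re * f.re + f₁.im * f.im) ^ 2
          = (f₁.re ^ 2 + f₁.im ^ 2) * ρ - (f₁.im * f.re - f₁.re * f.im) ^ 2 := by rw [hρ]; ring
      have l2 : ((profileDeriv a b s).re * (profile a b s).re
          + (profileDeriv a b s).im * (profile a b s).im) ^ 2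
          = ((profileDeriv a b s).re ^ 2 + (profileDeriv a b s).im ^ 2) * ρ
            - ((profileDeriv a b s).im * (profile a b s).re
              - (profileDeriv a b s).re * (profile a b s).im) ^ 2 := by rw [← hs]; ring
      rw [l1, l2, e2, show f₁.im * f.re - f₁.re * f.im = -(c₁ a b * h₁) by linarith,
        show f₁.re ^ 2 + f₁.im ^ 2
          = (profileDeriv a b s).re ^ 2 + (profileDeriv a b s).im ^ 2 by linarith]
    rcases sq_eq_sq_iff_eq_or_eq_neg.1 hsq with h5 | h5
    · exact h5
    -- Two opposite numbers with nonnegative product are both zero, so the signs cannot really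
    -- disagree.
    · have h6 : 0 ≤ (f₁.re * f.re + f₁.im * f.im) * ((profileDeriv a b s).re * (profile a b s).re
          + (profileDeriv a b s).im * (profile a b s).im) := by
        rw [e3, ← neg_mul, ← mul_assoc]
        exact mul_nonneg hsign (sq_nonneg _)
      rw [h5] at h6 ⊢
      generalize (profileDeriv a b s).re * (profile a b s).re
        + (profileDeriv a b s).im * (profile a b s).im = B at h6 ⊢
      have : B = 0 := mul_self_eq_zero.1 (le_antisymm (by linarith) (mul_self_nonneg B))
      rw [this, neg_zero]
  -- The amplitudes `θ` and `-θ` give the same radius and opposite signs of `sn`.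
  rcases le_total (f₁.re * f.re + f₁.im * f.im) 0 with hσ | hσ
  · obtain ⟨j1, j2, j3⟩ := jacobi_ellipticF h hθ1
    refine main (ellipticF θ (a / b) / b) ?_ ?_
    · rw [normSq_profile h, j1, j2, j3, hθρ]
    · rw [j1]
      exact mul_nonneg_of_nonpos_of_nonpos hσ (neg_nonpos.2 (mul_nonneg h.nonneg hsin))
  · obtain ⟨j1, j2, j3⟩ := jacobi_ellipticF h hθ2
    refine main (ellipticF (-θ) (a / b) / b) ?_ ?_
    · rw [normSq_profile h, j1, j2, j3, Real.sin_neg, Real.cos_neg, neg_sq, hθρ]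
    · rw [j1, Real.sin_neg, mul_neg a, neg_neg]
      exact mul_nonneg hσ (mul_nonneg h.nonneg hsin)

theorem IsConformalCurve.eq_profile {L : ℝ} {I : Set ℝ} {p φ : ℝ → ℝ} {f f₁ : ℝ → ℂ} {h h₁ : ℝ → ℝ}
    (hc : IsConformalCurve 1 L I p f f₁ h h₁) (hL : 0 ≤ L) (hI : IsOpen I) (hI' : IsPreconnected I)
    (hp : ContinuousOn p I) (hφ : ∀ u ∈ I, HasDerivAt φ (p u) u) {u₀ : ℝ} (hu₀ : u₀ ∈ I)
    (hφ₀ : φ u₀ = 0) :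
    ∃ a b s α t : ℝ, IsAdmissible a b ∧ c₁ a b = L ∧ ∀ u ∈ I,
      f u = Complex.exp (Complex.I * α) * profile a b (φ u + s) ∧
      h u = height a b (φ u + s) + t := by
  -- The first integral of the vertical equation.
  obtain ⟨m, hm⟩ : ∃ m, ∀ u ∈ I, h₁ u = m - ((f u).re ^ 2 + (f u).im ^ 2) / 2 := by
    refine ⟨h₁ u₀ + ((f u₀).re ^ 2 + (f u₀).im ^ 2) / 2, fun u hu => ?_⟩
    have := eq_add_of_hasDerivAt hI hI' (hc.hasDerivAt_vert₁) (fun u hu =>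
      ((hasDerivAt_normSq (hc.hasDerivAt_horiz u hu)).neg).congr_deriv (by
        simp only [Complex.re_ofReal_mul, Complex.im_ofReal_mul]; ring)) hu₀ u hu
    simp only [Pi.neg_apply] at this
    linarith
  have hle : h₁ u₀ ^ 2 ≤ (f u₀).re ^ 2 + (f u₀).im ^ 2 := by
    have e1 := hc.norm_eq u₀ hu₀
    have e2 := hc.orthogonal u₀ hu₀
    have e3 := hc.pos u₀ hu₀
    -- From `Re(f₁ f̄)² + Im(f₁ f̄)² = |f₁|² |f|²` and the two conformality relations.
    have e4 : ((f₁ u₀).re * (f u₀).re + (f₁ u₀).im * (f u₀).im) ^ 2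
        = ((f u₀).re ^ 2 + (f u₀).im ^ 2 + L ^ 2) * ((f u₀).re ^ 2 + (f u₀).im ^ 2 - h₁ u₀ ^ 2) := by
      linear_combination ((f u₀).re ^ 2 + (f u₀).im ^ 2) * e1
        - ((f₁ u₀).im * (f u₀).re - (f₁ u₀).re * (f u₀).im - L * h₁ u₀) * e2
    by_contra! hlt
    nlinarith [mul_pos e3 (sub_pos.2 hlt),
      sq_nonneg ((f₁ u₀).re * (f u₀).re + (f₁ u₀).im * (f u₀).im)]
  -- Indeed `2m + 1 = 2h₁ + |f|² + 1 ≥ (h₁ + 1)²`, so `2m + 1` can be written as `(ab)²`.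
  have hm0 : 0 ≤ 2 * m + 1 := by
    have := hm u₀ hu₀
    nlinarith [sq_nonneg (h₁ u₀ + 1)]
  obtain ⟨a, b, hab, hcL, habP⟩ := exists_admissible hL (Real.sqrt_nonneg (2 * m + 1))
  have hm' : m = (a ^ 2 * b ^ 2 - 1) / 2 := by
    have := Real.sq_sqrt hm0
    rw [← habP] at this
    linarith
  obtain ⟨s, α, hs, hs₁⟩ := exists_match (f := f u₀) (f₁ := f₁ u₀) (h₁ := h₁ u₀) hab
    (by rw [hcL]; exact hc.norm_eq u₀ hu₀) (by rw [hcL]; exact hc.orthogonal u₀ hu₀)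
    (by rw [hcL]; exact hc.pos u₀ hu₀) (by rw [← hm']; exact hm u₀ hu₀) hle
  have he := normSq_exp_I_mul α
  have hnormSq : ∀ z : ℂ, (Complex.exp (Complex.I * α) * z).re ^ 2
      + (Complex.exp (Complex.I * α) * z).im ^ 2 = z.re ^ 2 + z.im ^ 2 := fun z => by
    rw [Complex.mul_re, Complex.mul_im]
    linear_combination (z.re ^ 2 + z.im ^ 2) * he
  -- The first integral eliminates the vertical velocity, so `(f, f₁)` follows a smooth autonomous
  -- field, which both the given curve and the rotated profile satisfy.
  obtain ⟨V, hV⟩ : ∃ V : ℂ × ℂ → ℂ × ℂ, V = fun y =>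
    (y.2, ((1 + m - (y.1.re ^ 2 + y.1.im ^ 2) / 2 : ℝ) : ℂ) * y.1 + Complex.I * L * y.2) := ⟨_, rfl⟩
  have hVs : ContDiff ℝ 1 V := by
    have hre : ContDiff ℝ 1 fun y : ℂ × ℂ => y.1.re := Complex.reCLM.contDiff.comp contDiff_fst
    have him : ContDiff ℝ 1 fun y : ℂ × ℂ => y.1.im := Complex.imCLM.contDiff.comp contDiff_fst
    rw [hV]
    refine contDiff_snd.prodMk (((Complex.ofRealCLM.contDiff.comp
      (contDiff_const.sub (((hre.pow 2).add (him.pow 2)).div_const 2))).mul contDiff_fst).add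
      (contDiff_const.mul contDiff_snd))
  have hφs : ∀ u ∈ I, HasDerivAt (fun u => φ u + s) (p u) u := fun u hu => (hφ u hu).add_const s
  have hEq := eqOn_of_hasDerivAt_smul hVs hI hI' hp (y₁ := fun u => (f u, f₁ u))
    (y₂ := fun u => (Complex.exp (Complex.I * α) * profile a b (φ u + s),
      Complex.exp (Complex.I * α) * profileDeriv a b (φ u + s)))
    (fun u hu => by
      refine ((hc.hasDerivAt_horiz u hu).prodMk (hc.hasDerivAt_horiz₁ u hu)).congr_deriv ?_
      rw [hV, hm u hu]
      ext1
      · simp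
      · simp only [Prod.smul_snd, Complex.real_smul]
        push_cast
        ring)
    (fun u hu => by
      refine ((((hasDerivAt_profile hab _).scomp u (hφs u hu)).const_mul _).prodMk
        (((hasDerivAt_profileDeriv hab _).scomp u (hφs u hu)).const_mul _)).congr_deriv ?_
      rw [hV, heightDeriv_eq hab, ← hm', hcL]
      ext1
      · simp only [Prod.smul_fst, Complex.real_smul]
        ring
      · simp only [Prod.smul_snd, Complex.real_smul, hnormSq]
        push_cast
        ring)
    hu₀ (by simp only [hφ₀, zero_add]; rw [← hs, ← hs₁])
  have hf : ∀ u ∈ I, f u = Complex.exp (Complex.I * α) * profile a b (φ u + s) := fun u hu =>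
    congrArg Prod.fst (hEq hu)
  refine ⟨a, b, s, α, h u₀ - height a b (φ u₀ + s), hab, hcL, fun u hu => ⟨hf u hu,
    eq_add_of_hasDerivAt (g := fun u => height a b (φ u + s)) hI hI' hc.hasDerivAt_vert
      (fun u hu => ?_) hu₀ u hu⟩⟩
  refine ((hasDerivAt_height hab _).comp u (hφs u hu)).congr_deriv ?_
  rw [heightDeriv_eq hab, hm u hu, hf u hu, hnormSq, hm']
  ring

theorem IsCmcHelicoid.exists_explicit {H l : ℝ} {I : Set ℝ} {x : ℝ → ℝ → E3}
    (hx : IsCmcHelicoid H l I x) :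
    ∃ (a b ε t : ℝ) (φ ψ : ℝ → ℝ), 0 ≤ a ∧ a ≤ 1 ∧ 1 ≤ b ∧ (ε = 1 ∨ ε = -1) ∧
      ContDiffOn ℝ ∞ φ I ∧ ContDiffOn ℝ ∞ ψ I ∧ (∀ u ∈ I, 0 < ε * deriv φ u) ∧
      ∀ u ∈ I, ∀ v : ℝ,
        x u v = explicitHelicoid a b (ε * H) (φ u) (v + ψ u) + ![0, 0, t] := by
  -- The empty set is preconnected, hence allowed for `I`; any admissible parameters serve there.
  rcases I.eq_empty_or_nonempty with rfl | ⟨u₀, hu₀⟩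
  · exact ⟨0, 1, 1, 0, 0, 0, le_rfl, zero_le_one, le_rfl, Or.inl rfl, contDiffOn_const,
      contDiffOn_const, by simp, by simp⟩
  -- The scaled pitch must equal `c₁`, a nonnegative square root; reversing the normal changes its
  -- sign.
  obtain ⟨ε, hε, hL⟩ : ∃ ε : ℝ, (ε = 1 ∨ ε = -1) ∧ 0 ≤ -2 * H * ε * l := by
    rcases le_total (H * l) 0 with h | h
    · exact ⟨1, Or.inl rfl, by linarith⟩
    · exact ⟨-1, Or.inr rfl, by linarith⟩
  have hH := hx.ne_zero
  have hε0 : ε ≠ 0 := by rcases hε with rfl | rfl <;> norm_num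
  have hκ : -2 * H * ε ≠ 0 := by simp [hH, hε0]
  obtain ⟨p, φ, ψ, f, f₁, h, h₁, hφ₀, hφs, hψs, hp, hφ, hεp, hc, hxf⟩ :=
    exists_isConformalCurve hx hu₀ hε
  obtain ⟨a, b, s, α, t, hab, hcL, hfh⟩ :=
    (hc.const_mul hκ).eq_profile hL hx.isOpen hx.isPreconnected hp hφ hu₀ hφ₀
  -- The rotation by `α` is absorbed into the angle of the helicoidal motion, which also raises the
  -- surface by `l α`; the translation compensates for this.
  refine ⟨a, b, ε, (-2 * H * ε)⁻¹ * t - l * α, fun u => φ u + s, fun u => ψ u + α, hab.nonneg,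
    hab.le_one, hab.one_le, hε, hφs.add contDiffOn_const, hψs.add contDiffOn_const, ?_, ?_⟩
  · intro u hu
    rw [((hφ u hu).add_const s).deriv]
    exact hεp u hu
  · intro u hu v
    obtain ⟨h1, h2⟩ := hfh u hu
    have hκc : ((-2 * H * ε : ℝ) : ℂ) ≠ 0 := by exact_mod_cast hκ
    have hf : f u = ((-2 * H * ε : ℝ) : ℂ)⁻¹
        * (Complex.exp (Complex.I * α) * profile a b (φ u + s)) := by
      rw [← h1, inv_mul_cancel_left₀ hκc]
    have hh : h u = (-2 * H * ε)⁻¹ * (height a b (φ u + s) + t) := by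
      rw [← h2, inv_mul_cancel_left₀ hκ]
    have hl : -c₁ a b / (2 * (ε * H)) = l := by rw [hcL]; field_simp
    have hz : (![0, 0, (-2 * H * ε)⁻¹ * t - l * α] : E3)
        = toE3 0 ((-2 * H * ε)⁻¹ * t - l * α) := by simp [toE3]
    rw [hxf u hu v, explicitHelicoid_eq (mul_ne_zero hε0 hH), hl, hz, explicitCurve, smul_toE3,
      helicoidalMotion_toE3, helicoidalMotion_toE3, toE3_add, hf, hh,
      show -2 * (ε * H) = -2 * H * ε by ring]
    have hexp : Complex.exp (Complex.I * ((v + (ψ u + α) : ℝ) : ℂ))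
        = Complex.exp (Complex.I * ((v + ψ u : ℝ) : ℂ)) * Complex.exp (Complex.I * α) := by
      rw [← Complex.exp_add]; push_cast; ring_nf
    rw [hexp]
    congr 1
    · push_cast; ring
    · ring

end CmcHelicoid
end

open CmcHelicoid
theorem proposition5p7 :
    -- The formula gives a cmc-`H` helicoid, in isothermal parameters.
    (∀ a b H : ℝ, 0 ≤ a → a ≤ 1 → 1 ≤ b → H ≠ 0 →
      IsCmcHelicoid H (-c₁ a b / (2 * H)) Set.univ (explicitHelicoid a b H) ∧
      IsIsothermal (explicitHelicoid a b H) ∧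
      (0 < a → a < 1 → b = 1 → IsUnduloid H (explicitHelicoid a b H)) ∧
      (a = 1 → 1 < b → IsNodoid H (explicitHelicoid a b H))) ∧
    -- Conversely, every cmc-`H` helicoid is obtained, after a change of parameters and a
    -- translation along the axis; `ε = -1` is a change of the unit normal.
    (∀ (H l : ℝ) (I : Set ℝ) (x : ℝ → ℝ → E3), IsCmcHelicoid H l I x →
      ∃ (a b ε t : ℝ) (φ ψ : ℝ → ℝ), 0 ≤ a ∧ a ≤ 1 ∧ 1 ≤ b ∧ (ε = 1 ∨ ε = -1) ∧
        ContDiffOn ℝ ∞ φ I ∧ ContDiffOn ℝ ∞ ψ I ∧ (∀ u ∈ I, 0 < ε * deriv φ u) ∧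
        ∀ u ∈ I, ∀ v : ℝ,
          x u v = explicitHelicoid a b (ε * H) (φ u) (v + ψ u) + ![0, 0, t]) := by
  refine ⟨fun a b H ha ha' hb hH => ?_, fun H l I x hx => hx.exists_explicit⟩
  have h : IsAdmissible a b := ⟨ha, ha', hb⟩
  refine ⟨isCmcHelicoid_explicit h hH, isIsothermal_explicit h hH, ?_, ?_⟩
  · rintro ha₀ ha₁ rfl
    exact isUnduloid_explicit h ha₀ ha₁ hH
  · rintro rfl hb₁
    exact isNodoid_explicit hb₁ hH
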